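/- Let $I=[0,1]$, $m\in\mathbb N$, and let $\|\cdot\|$ be the norm of $L^2(I)$. Let $f:\mathbb R\times\mathbb R\to\mathbb R$, $(u,t)\mapsto f(u,t)$, be Lipschitz continuous in $u$ with a constant independent of $t$, and continuous in $t$; let $D_k:\mathbb R\to\mathbb R$, $k=1,\dots,m$, be bounded and Lipschitz continuous; let $g\in L^2(I)$; and let $W_k\in L^2(I^2)$, $k=1,\dots,m$, satisfy, with constants $C_1,C_2$ independent of $k$, $$\operatorname*{ess\,sup}_{y\in I}\int_I|W_k(x,y)|\,dx\le C_1,\qquad \operatorname*{ess\,sup}_{x\in I}\int_I|W_k(x,y)|\,dy\le C_2 .$$ For $n\ge1$ put $I_i^n=[(i-1)/n,i/n)$ for $i<n$ and $I_n^n=[(n-1)/n,1]$, and for integrable $W$ on $I^2$ put $\langle W\rangle_{ij}^n=n^2\int_{I_i^n\times I_j^n}W(x,y)\,dx\,dy$. For each $k$ let $\alpha_{kn}=n^{-\gamma_k}$, and let the weights $w_{ij}^{kn}$, $i,j\in\{1,\dots,n\}$, of a sequence of graphs $G_{kn}$ be given in one of the following ways (which may differ for different $k$): - deterministic dense: $\gamma_k=0$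 and $w_{ij}^{kn}=\langle W_k\rangle_{ij}^n$; - random dense: $\gamma_k=0$, $0\le W_k\le1$, and $w_{ij}^{kn}\in\{0,1\}$ is random with $\mathbb P(w_{ij}^{kn}=1)=\langle W_k\rangle_{ij}^n$; - random sparse: $\gamma_k\in(0,\tfrac12)$, $W_k\ge0$, and $w_{ij}^{kn}\in\{0,1\}$ is random with $\mathbb P(w_{ij}^{kn}=1)=\alpha_{kn}\langle\min(\alpha_{kn}^{-1},W_k)\rangle_{ij}^n$. The graphs $G_{kn}$ may be directed or, if $W_k$ is symmetric, undirected, i.e. $w_{ij}^{kn}=w_{ji}^{kn}$. All random weights are defined on one probability space and, for each $n$, the weights $w_{ij}^{kn}$ of all random graphs are independent (for an undirected graph, those with $i\le j$). Let $(u_1^n(t),\dots,u_n^n(t))$, $t\in\mathbb R$, be the solution of $$\frac{d}{dt}u_i^n(t)=f(u_i^n(t),t)+\sum_{k=1}^m\frac1{n\alpha_{kn}}\sum_{j=1}^n w_{ij}^{kn}D_k\bigl(u_j^n(t)-u_i^n(t)\bigr),\qquad u_i^n(0)=n\int_{I_i^n}g(x)\,dx,\qquad i=1,\dots,n,$$ and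 put $\mathbf u_n(t)=\sum_{i=1}^n u_i^n(t)\mathbf 1_{I_i^n}\in L^2(I)$. Let $\mathbf u\in C^1(\mathbb R;L^2(I))$, $\mathbf u(t)=u(t,\cdot)$, be the solution of $$\frac{\partial}{\partial t}u(t,x)=f(u(t,x),t)+\sum_{k=1}^m\int_I W_k(x,y)D_k\bigl(u(t,y)-u(t,x)\bigr)\,dy,\qquad u(0,\cdot)=g .$$ Then for every $T>0$, $$\lim_{n\to\infty}\max_{t\in[0,T]}\|\mathbf u_n(t)-\mathbf u(t)\|=0\quad\text{almost surely}.$$ -/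

import Mathlib

open MeasureTheory ProbabilityTheory Filter Topology Set
open scoped ENNReal NNReal

namespace OscillatorNetwork

noncomputable section

/-- Lebesgue measure on `I = [0,1]`, as a measure on `ℝ` carried by `I`. -/
abbrev μI : Measure ℝ := volume.restrict (Icc (0 : ℝ) 1)

/-- The space `L²(I)`. -/
abbrev L2I : Type := Lp ℝ 2 μI

/-- The cells of the uniform mesh of `I`; nodes are numbered from `0`, so `cell n i` is
`[i/n, (i+1)/n)` for `i < n - 1` and `[(n-1)/n, 1]` for `i = n - 1`. -/
def cell (n : ℕ) (i : Fin n) : Set ℝ :=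
  if (i : ℕ) + 1 < n then Ico ((i : ℝ) / n) (((i : ℝ) + 1) / n)
  else Icc ((i : ℝ) / n) (((i : ℝ) + 1) / n)

theorem measurableSet_cell (n : ℕ) (i : Fin n) : MeasurableSet (cell n i) := by
  unfold cell
  split_ifs
  · exact measurableSet_Ico
  · exact measurableSet_Icc

/-- The cell average `⟨W⟩ᵢⱼⁿ = n² ∫_{Iᵢ × Iⱼ} W`. -/
def cellAvg (W : ℝ × ℝ → ℝ) (n : ℕ) (i j : Fin n) : ℝ :=
  (n : ℝ) ^ 2 * ∫ p in cell n i ×ˢ cell n j, W p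

/-- The step function `∑ᵢ vᵢ 1_{Iᵢ}` as an element of `L²(I)`. -/
def stepLp (n : ℕ) (v : Fin n → ℝ) : L2I :=
  ∑ i, v i • indicatorConstLp 2 (measurableSet_cell n i) (measure_ne_top μI _) (1 : ℝ)

/-- The three kinds of graph sequences. -/
inductive GraphType
  | deterministicDense
  | randomDense
  | randomSparse

/-- The scaling factor `αₙ = n^{-γ}`. -/
def scaling (γ : ℝ) (n : ℕ) : ℝ := (n : ℝ) ^ (-γ)

/-- `w n k i j` is the weight of the edge `j → i` in the `k`-th graph on `n` nodes.
The predicate says that these weights are generated from the graphons `W k`, where `ty k` is the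
kind of the `k`-th sequence, `und k` says whether its graphs are undirected, and the scaling
factors are `n ^ (-γ k)`. Nothing is assumed on the joint law for different `n`. -/
structure IsGraphSequence {Ω : Type*} [MeasurableSpace Ω] (P : Measure Ω) {m : ℕ}
    (ty : Fin m → GraphType) (und : Fin m → Prop) (W : Fin m → ℝ × ℝ → ℝ) (γ : Fin m → ℝ)
    (w : (n : ℕ) → Fin m → Fin n → Fin n → Ω → ℝ) : Prop where
  deterministic : ∀ k, ty k = .deterministicDense →
    ∀ n i j ω, w n k i j ω = cellAvg (W k) n i j
  measurable : ∀ n k i j, Measurable (w n k i j)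
  zero_or_one : ∀ k, ty k ≠ .deterministicDense →
    ∀ n i j ω, w n k i j ω = 0 ∨ w n k i j ω = 1
  dense_range : ∀ k, ty k = .randomDense →
    ∀ᵐ p ∂(μI.prod μI), W k p ∈ Icc (0 : ℝ) 1
  dense_prob : ∀ k, ty k = .randomDense → ∀ n i j,
    P {ω | w n k i j ω = 1} = ENNReal.ofReal (cellAvg (W k) n i j)
  sparse_nonneg : ∀ k, ty k = .randomSparse → ∀ᵐ p ∂(μI.prod μI), 0 ≤ W k p
  sparse_prob : ∀ k, ty k = .randomSparse → ∀ n i j,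
    P {ω | w n k i j ω = 1} =
      ENNReal.ofReal (scaling (γ k) n *
        cellAvg (fun p => min (scaling (γ k) n)⁻¹ (W k p)) n i j)
  graphon_symm : ∀ k, und k → ∀ᵐ p ∂(μI.prod μI), W k p = W k p.swap
  weight_symm : ∀ k, und k → ∀ n i j ω, w n k i j ω = w n k j i ω
  /-- For each `n`, all edges of all graphs are independent; in an undirected graph the edges are
  the unordered pairs, listed as `i ≤ j`. (Deterministic weights are constants.) -/
  indep : ∀ n, iIndepFun
    (fun (e : {e : Fin m × Fin n × Fin n // und e.1 → e.2.1 ≤ e.2.2}) ω =>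
      w n e.1.1 e.1.2.1 e.1.2.2 ω) P

/-- `v` solves the network equation on `n` nodes with weights `w k i j` and scaling factors `α k`,
started from the cell averages of `g`. -/
structure IsDiscreteSolution {m : ℕ} (f : ℝ → ℝ → ℝ) (D : Fin m → ℝ → ℝ) (g : L2I) (n : ℕ)
    (α : Fin m → ℝ) (w : Fin m → Fin n → Fin n → ℝ) (v : ℝ → Fin n → ℝ) : Prop where
  initial : ∀ i, v 0 i = n * ∫ x in cell n i, g x
  ode : ∀ (t : ℝ) (i : Fin n), HasDerivAt (fun s => v s i)
    (f (v t i) t + ∑ k, 1 / (n * α k) * ∑ j, w k i j * D k (v t j - v t i)) t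

/-- `u ∈ C¹(ℝ; L²(I))` solves the continuum limit with initial value `g`. -/
structure IsContinuumSolution {m : ℕ} (f : ℝ → ℝ → ℝ) (D : Fin m → ℝ → ℝ)
    (W : Fin m → ℝ × ℝ → ℝ) (g : L2I) (u : ℝ → L2I) : Prop where
  contDiff : ContDiff ℝ 1 u
  initial : u 0 = g
  equation : ∀ t, ((deriv u t : L2I) : ℝ → ℝ) =ᵐ[μI] fun x =>
    f (u t x) t + ∑ k, ∫ y, W k (x, y) * D k (u t y - u t x) ∂μI

end

end OscillatorNetwork

namespace OscillatorNetwork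

noncomputable section

/-! Composing the right-hand side of the network equation with averaging over cells gives vector
fields G_n(t, ·) on all of L²(I), and the step functions built from the network solutions solve x' =
G_n(t, x). Convergence then follows from stability and consistency. Stability: almost surely, for
large n, all G_n(t, ·) share one Lipschitz constant, by a Schur test that uses both the row and the
column sums of the normalised weights w/α (`norm_stepLp_interaction_sub_le`). Consistency: G_n(t,
u(t)) - u'(t) tends to 0 uniformly on [0,T]. Gronwall's inequality combines the two
(`tendsto_uniformly_of_consistent`).

The consistency error has two parts. With the weights replaced by their means it is deterministic,
and is controlled by the L² distances from W_k to its (in the sparse case truncated) step kernel and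
from u(t) to its cell means (`norm_averaged_field_sub_le`). The rest is the fluctuation of the
weights. It is tested along the continuum solution u and not along the random network solution, so
D_k is evaluated at nonrandom numbers and each row is a weighted sum of independent centred
Bernoulli variables. A Chernoff bound that keeps the small variance makes a row fail with
probability at most 2 exp(-c n^{1-γ}); a union bound over the n rows and Borel–Cantelli finish
(`ae_tendsto_rows_bernoulli`). With unit coefficients the same estimate, for rows and for columns,
supplies the sums needed in the Schur test.

This treats countably many times, namely the rational ones. The fluctuation field is itself
Lipschitz by the Schur test and u is continuous, so the estimate spreads to all of [0,T]
(`eventually_forall_le_of_tendsto_rat`). -/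

/-! ### The uniform mesh and its step functions. -/

theorem cell_subset_Icc (n : ℕ) (i : Fin n) : cell n i ⊆ Icc (0 : ℝ) 1 := by
  have hn : (0 : ℝ) < n := by exact_mod_cast i.pos
  have hi : (i : ℝ) + 1 ≤ n := by exact_mod_cast i.isLt
  have h0 : (0 : ℝ) ≤ (i : ℝ) / n := by positivity
  have h1 : ((i : ℝ) + 1) / n ≤ 1 := (div_le_one hn).2 hi
  intro x hx
  unfold cell at hx
  split_ifs at hx
  · exact ⟨h0.trans hx.1, hx.2.le.trans h1⟩
  · exact ⟨h0.trans hx.1, hx.2.trans h1⟩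

theorem cell_subset_Icc_div (n : ℕ) (i : Fin n) :
    cell n i ⊆ Icc ((i : ℝ) / n) (((i : ℝ) + 1) / n) := by
  unfold cell
  split_ifs
  · exact Ico_subset_Icc_self
  · exact subset_rfl

theorem dist_le_of_mem_cell {n : ℕ} {i : Fin n} {x y : ℝ} (hx : x ∈ cell n i)
    (hy : y ∈ cell n i) : dist x y ≤ 1 / n := by
  have h := Real.dist_le_of_mem_Icc (cell_subset_Icc_div n i hx) (cell_subset_Icc_div n i hy)
  have : ((i : ℝ) + 1) / n - (i : ℝ) / n = 1 / n := by ring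
  rwa [this] at h

theorem volume_cell (n : ℕ) (i : Fin n) : volume (cell n i) = ENNReal.ofReal (1 / n) := by
  have : ((i : ℝ) + 1) / n - (i : ℝ) / n = 1 / n := by ring
  unfold cell
  split_ifs
  · rw [Real.volume_Ico, this]
  · rw [Real.volume_Icc, this]

theorem restrict_cell (n : ℕ) (i : Fin n) : μI.restrict (cell n i) = volume.restrict (cell n i) :=
  Measure.restrict_restrict_of_subset (cell_subset_Icc n i)

theorem measure_cell (n : ℕ) (i : Fin n) : μI (cell n i) = ENNReal.ofReal (1 / n) := by
  rw [Measure.restrict_apply (measurableSet_cell n i),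
    inter_eq_self_of_subset_left (cell_subset_Icc n i), volume_cell]

theorem measureReal_cell (n : ℕ) (i : Fin n) : μI.real (cell n i) = 1 / n := by
  rw [measureReal_def, measure_cell, ENNReal.toReal_ofReal (by positivity)]

theorem disjoint_cell_of_lt {n : ℕ} {i j : Fin n} (h : i < j) :
    Disjoint (cell n i) (cell n j) := by
  have hn : (0 : ℝ) < n := by exact_mod_cast i.pos
  have hij : (i : ℝ) + 1 ≤ j := by exact_mod_cast h
  have hi : (i : ℕ) + 1 < n := lt_of_le_of_lt (Nat.succ_le_of_lt h) j.isLt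
  refine Set.disjoint_left.2 fun x hx hx' => ?_
  rw [cell, if_pos hi] at hx
  have h1 := (cell_subset_Icc_div n j hx').1
  have h2 : ((i : ℝ) + 1) / n ≤ j / n := by gcongr
  exact absurd hx.2 (not_lt.2 (h2.trans h1))

theorem pairwise_disjoint_cell (n : ℕ) : Pairwise (Function.onFun Disjoint (cell n)) := by
  intro i j hij
  rcases lt_or_gt_of_ne hij with h | h
  · exact disjoint_cell_of_lt h
  · exact (disjoint_cell_of_lt h).symm

theorem exists_mem_cell {n : ℕ} (hn : 0 < n) {x : ℝ} (hx : x ∈ Icc (0 : ℝ) 1) :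
    ∃ i, x ∈ cell n i := by
  have hn' : (0 : ℝ) < n := by exact_mod_cast hn
  have hfl := Nat.floor_le (mul_nonneg hn'.le hx.1)
  have hlt := Nat.lt_floor_add_one ((n : ℝ) * x)
  -- The cell index is ⌊nx⌋, except that the closed last cell takes every x with ⌊nx⌋ ≥ n - 1,
  -- including x = 1.
  by_cases h : ⌊(n : ℝ) * x⌋₊ + 1 < n
  · refine ⟨⟨⌊(n : ℝ) * x⌋₊, by omega⟩, ?_⟩
    rw [cell, if_pos h]
    exact ⟨(div_le_iff₀ hn').2 (by linarith), (lt_div_iff₀ hn').2 (by linarith)⟩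
  · refine ⟨⟨n - 1, by omega⟩, ?_⟩
    have hle : (n - 1 : ℕ) ≤ ⌊(n : ℝ) * x⌋₊ := by omega
    have hc : ((n - 1 : ℕ) : ℝ) = n - 1 := by rw [Nat.cast_sub hn]; simp
    have hle' : ((n - 1 : ℕ) : ℝ) ≤ ⌊(n : ℝ) * x⌋₊ := by exact_mod_cast hle
    rw [cell, if_neg (by simp; omega)]
    refine ⟨(div_le_iff₀ hn').2 (by simp only; linarith), (le_div_iff₀ hn').2 ?_⟩
    simp only [hc]
    nlinarith [hx.2]

/-- The step function `∑ᵢ vᵢ 1_{Iᵢ}`. -/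
def stepFun (n : ℕ) (v : Fin n → ℝ) (x : ℝ) : ℝ := ∑ i, (cell n i).indicator (fun _ => v i) x

/-- The averages of a function over the cells of the mesh. -/
def cellMean (n : ℕ) (φ : ℝ → ℝ) (i : Fin n) : ℝ := n * ∫ x in cell n i, φ x

theorem stepFun_of_mem {n : ℕ} {i : Fin n} {x : ℝ} (hx : x ∈ cell n i) (v : Fin n → ℝ) :
    stepFun n v x = v i := by
  unfold stepFun
  rw [Finset.sum_eq_single i]
  · exact indicator_of_mem hx _
  · intro j _ hj
    exact indicator_of_notMem
      (fun hx' => Set.disjoint_left.1 (pairwise_disjoint_cell n hj) hx' hx) _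
  · simp

theorem measurable_stepFun (n : ℕ) (v : Fin n → ℝ) : Measurable (stepFun n v) :=
  Finset.measurable_fun_sum _ fun i _ => measurable_const.indicator (measurableSet_cell n i)

theorem coeFn_stepLp (n : ℕ) (v : Fin n → ℝ) : stepLp n v =ᵐ[μI] stepFun n v := by
  have h : ∀ i, (v i • indicatorConstLp 2 (measurableSet_cell n i) (measure_ne_top μI _) (1 : ℝ) :
      L2I) =ᵐ[μI] (cell n i).indicator (fun _ => v i) := by
    intro i
    filter_upwards [Lp.coeFn_smul (v i)
        (indicatorConstLp 2 (measurableSet_cell n i) (measure_ne_top μI _) (1 : ℝ)),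
      indicatorConstLp_coeFn (p := 2) (hs := measurableSet_cell n i)
        (hμs := measure_ne_top μI _) (c := (1 : ℝ))] with x h1 h2
    rw [h1, Pi.smul_apply, h2]
    by_cases hx : x ∈ cell n i <;> simp [hx]
  filter_upwards [Lp.coeFn_fun_finsetSum Finset.univ fun i =>
      (v i • indicatorConstLp 2 (measurableSet_cell n i) (measure_ne_top μI _) (1 : ℝ) : L2I),
    ae_all_iff.2 h] with x h1 h2
  rw [stepLp, h1, stepFun]
  exact Finset.sum_congr rfl fun i _ => h2 i

theorem integral_stepFun (n : ℕ) (v : Fin n → ℝ) :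
    ∫ x, stepFun n v x ∂μI = 1 / n * ∑ i, v i := by
  unfold stepFun
  rw [integral_finsetSum _ fun i _ => (integrable_const _).indicator (measurableSet_cell n i),
    Finset.mul_sum]
  refine Finset.sum_congr rfl fun i _ => ?_
  rw [integral_indicator_const _ (measurableSet_cell n i), measureReal_cell, smul_eq_mul]

/-- F must fix 0 because a step function vanishes off the cells. -/
theorem stepFun_map {n : ℕ} (v : Fin n → ℝ) {F : ℝ → ℝ} (hF : F 0 = 0) (x : ℝ) :
    F (stepFun n v x) = stepFun n (fun i => F (v i)) x := by
  by_cases h : ∃ i, x ∈ cell n i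
  · obtain ⟨i, hi⟩ := h
    rw [stepFun_of_mem hi, stepFun_of_mem hi]
  · push Not at h
    simp [stepFun, h, hF]

theorem norm_sq_stepLp (n : ℕ) (v : Fin n → ℝ) : ‖stepLp n v‖ ^ 2 = 1 / n * ∑ i, v i ^ 2 := by
  rw [← real_inner_self_eq_norm_sq, L2.inner_def, ← integral_stepFun]
  refine integral_congr_ae ?_
  filter_upwards [coeFn_stepLp n v] with x hx
  rw [hx, ← stepFun_map (F := fun y => y ^ 2) v (by simp)]
  simp [sq]

theorem stepLp_sub (n : ℕ) (v w : Fin n → ℝ) : stepLp n (v - w) = stepLp n v - stepLp n w := by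
  simp [stepLp, sub_smul, Finset.sum_sub_distrib]

theorem stepLp_add (n : ℕ) (v w : Fin n → ℝ) : stepLp n (v + w) = stepLp n v + stepLp n w := by
  simp [stepLp, add_smul, Finset.sum_add_distrib]

theorem stepLp_sum {ι : Type*} (s : Finset ι) (n : ℕ) (v : ι → Fin n → ℝ) :
    stepLp n (∑ k ∈ s, v k) = ∑ k ∈ s, stepLp n (v k) := by
  classical
  induction s using Finset.induction_on with
  | empty => simp [stepLp]
  | insert a s ha ih => rw [Finset.sum_insert ha, Finset.sum_insert ha, stepLp_add, ih]

theorem norm_stepLp_le_of_sq_le {n : ℕ} {v w : Fin n → ℝ} {c : ℝ} (hc : 0 ≤ c)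
    (h : ∑ i, v i ^ 2 ≤ c ^ 2 * ∑ i, w i ^ 2) : ‖stepLp n v‖ ≤ c * ‖stepLp n w‖ := by
  refine abs_le_of_sq_le_sq' ?_ (by positivity) |>.2
  rw [mul_pow, norm_sq_stepLp, norm_sq_stepLp, mul_left_comm]
  gcongr

theorem norm_stepLp_le_of_abs_le {n : ℕ} {v : Fin n → ℝ} {c : ℝ} (hc : 0 ≤ c)
    (h : ∀ i, |v i| ≤ c) : ‖stepLp n v‖ ≤ c := by
  refine abs_le_of_sq_le_sq' ?_ hc |>.2
  rw [norm_sq_stepLp]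
  rcases Nat.eq_zero_or_pos n with rfl | hn
  · simp; positivity
  · calc 1 / (n : ℝ) * ∑ i, v i ^ 2 ≤ 1 / n * ∑ _i : Fin n, c ^ 2 := by
          gcongr 1 / (n : ℝ) * ?_
          exact Finset.sum_le_sum fun i _ => sq_le_sq.2 (by rw [abs_of_nonneg hc]; exact h i)
      _ = c ^ 2 := by
          simp only [Finset.sum_const, Finset.card_univ, Fintype.card_fin, nsmul_eq_mul]
          field_simp

/-- This makes the network equation an equation in L²: averaging a step function loses nothing, so
precomposing the field with `cellMean` leaves the network dynamics unchanged. -/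
theorem cellMean_stepLp {n : ℕ} (v : Fin n → ℝ) : cellMean n (stepLp n v) = v := by
  funext i
  have hn : (n : ℝ) ≠ 0 := by exact_mod_cast i.pos.ne'
  rw [cellMean, ← restrict_cell]
  have : ∫ x in cell n i, stepLp n v x ∂μI = ∫ _x in cell n i, v i ∂μI := by
    refine integral_congr_ae ?_
    filter_upwards [ae_restrict_of_ae (coeFn_stepLp n v),
      ae_restrict_mem (measurableSet_cell n i)] with x h1 h2
    rw [h1, stepFun_of_mem h2]
  rw [this, setIntegral_const, measureReal_cell, smul_eq_mul]
  field_simp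

theorem cellMean_sub (n : ℕ) (φ ψ : L2I) :
    cellMean n (φ - ψ : L2I) = cellMean n φ - cellMean n ψ := by
  funext i
  have hφ : Integrable φ (μI.restrict (cell n i)) :=
    ((Lp.memLp φ).integrable (by norm_num)).integrableOn
  have hψ : Integrable ψ (μI.restrict (cell n i)) :=
    ((Lp.memLp ψ).integrable (by norm_num)).integrableOn
  simp only [cellMean, Pi.sub_apply, ← restrict_cell, ← mul_sub]
  rw [← integral_sub hφ hψ]
  congr 1
  exact integral_congr_ae (ae_restrict_of_ae (Lp.coeFn_sub φ ψ))

/-! ### Averages over partitions in L². -/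

theorem eLpNorm_two_sq {X : Type*} [MeasurableSpace X] (μ : Measure X) (h : X → ℝ) :
    eLpNorm h 2 μ ^ 2 = ∫⁻ x, ‖h x‖ₑ ^ 2 ∂μ := by
  have := eLpNorm_nnreal_pow_eq_lintegral (μ := μ) (f := h) (p := 2) (by norm_num)
  simpa using this

theorem lintegral_mul_sq_le {X : Type*} [MeasurableSpace X] (μ : Measure X) {a b : X → ℝ≥0∞}
    (ha : AEMeasurable a μ) (hb : AEMeasurable b μ) :
    (∫⁻ x, a x * b x ∂μ) ^ 2 ≤ (∫⁻ x, a x ^ 2 ∂μ) * ∫⁻ x, b x ^ 2 ∂μ := by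
  have h := ENNReal.lintegral_mul_le_Lp_mul_Lq μ Real.HolderConjugate.two_two ha hb
  simp only [Pi.mul_apply] at h
  calc (∫⁻ x, a x * b x ∂μ) ^ 2 ≤ _ := pow_le_pow_left' h 2
    _ = _ := by
      rw [mul_pow]
      simp only [← ENNReal.rpow_natCast, ← ENNReal.rpow_mul]
      norm_num

/-- The function which equals on each `s i` the average of `h` over `s i`. -/
def partAvg {X ι : Type*} [MeasurableSpace X] [Fintype ι] (μ : Measure X) (s : ι → Set X)
    (h : X → ℝ) (x : X) : ℝ :=
  ∑ i, (s i).indicator (fun _ => ⨍ y in s i, h y ∂μ) x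

section partAvg

variable {X ι : Type*} [MeasurableSpace X] [Fintype ι] {μ : Measure X} {s : ι → Set X}

theorem partAvg_of_mem (hd : Pairwise (Function.onFun Disjoint s)) {i : ι} {x : X}
    (hx : x ∈ s i) (h : X → ℝ) : partAvg μ s h x = ⨍ y in s i, h y ∂μ := by
  classical
  unfold partAvg
  rw [Finset.sum_eq_single i]
  · exact indicator_of_mem hx _
  · intro j _ hj
    exact indicator_of_notMem (fun hx' => Set.disjoint_left.1 (hd hj) hx' hx) _
  · simp

theorem measurable_partAvg (hs : ∀ i, MeasurableSet (s i)) (h : X → ℝ) :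
    Measurable (partAvg μ s h) :=
  Finset.measurable_fun_sum _ fun i _ => measurable_const.indicator (hs i)

theorem partAvg_sub {g h : X → ℝ} (hg : Integrable g μ) (hh : Integrable h μ) :
    partAvg μ s (g - h) = partAvg μ s g - partAvg μ s h := by
  funext x
  simp only [partAvg, Pi.sub_apply, ← Finset.sum_sub_distrib]
  refine Finset.sum_congr rfl fun i _ => ?_
  by_cases hx : x ∈ s i
  · simp only [hx, indicator_of_mem, setAverage_eq]
    rw [integral_sub hg.integrableOn hh.integrableOn, smul_sub]
  · simp [hx]

/-- Cauchy–Schwarz against the constant 1 on t. -/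
theorem enorm_setAverage_sq_mul_le [IsFiniteMeasure μ] (t : Set X) {h : X → ℝ}
    (hh : AEStronglyMeasurable h μ) :
    ‖⨍ y in t, h y ∂μ‖ₑ ^ 2 * μ t ≤ ∫⁻ y in t, ‖h y‖ₑ ^ 2 ∂μ := by
  rcases eq_or_ne (μ t) 0 with h0 | h0
  · simp [h0]
  have h1 : ‖∫ y in t, h y ∂μ‖ₑ ^ 2 ≤ μ t * ∫⁻ y in t, ‖h y‖ₑ ^ 2 ∂μ := by
    calc ‖∫ y in t, h y ∂μ‖ₑ ^ 2 ≤ (∫⁻ y in t, 1 * ‖h y‖ₑ ∂μ) ^ 2 := by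
          gcongr
          simpa using enorm_integral_le_lintegral_enorm (μ := μ.restrict t) h
      _ ≤ _ := (lintegral_mul_sq_le (μ.restrict t) aemeasurable_const hh.restrict.enorm)
      _ = _ := by simp
  have h2 : ‖(μ.real t)⁻¹‖ₑ = (μ t)⁻¹ := by
    rw [enorm_inv (by simp [measureReal_def, ENNReal.toReal_eq_zero_iff, h0]), measureReal_def,
      Real.enorm_toReal (measure_ne_top μ t)]
  rw [setAverage_eq, enorm_smul, h2]
  calc ((μ t)⁻¹ * ‖∫ y in t, h y ∂μ‖ₑ) ^ 2 * μ t
      = (μ t)⁻¹ ^ 2 * μ t * ‖∫ y in t, h y ∂μ‖ₑ ^ 2 := by ring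
    _ ≤ (μ t)⁻¹ ^ 2 * μ t * (μ t * ∫⁻ y in t, ‖h y‖ₑ ^ 2 ∂μ) := by gcongr
    _ = ((μ t)⁻¹ * μ t) ^ 2 * ∫⁻ y in t, ‖h y‖ₑ ^ 2 ∂μ := by ring
    _ = _ := by rw [ENNReal.inv_mul_cancel h0 (measure_ne_top μ t)]; simp

theorem eLpNorm_partAvg_le [IsFiniteMeasure μ] (hs : ∀ i, MeasurableSet (s i))
    (hd : Pairwise (Function.onFun Disjoint s)) {h : X → ℝ} (hh : AEStronglyMeasurable h μ) :
    eLpNorm (partAvg μ s h) 2 μ ≤ eLpNorm h 2 μ := by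
  refine (ENNReal.pow_le_pow_left_iff two_ne_zero).1 ?_
  rw [eLpNorm_two_sq, eLpNorm_two_sq]
  have hpt : ∀ x, ‖partAvg μ s h x‖ₑ ^ 2 =
      ∑ i, (s i).indicator (fun _ => ‖⨍ y in s i, h y ∂μ‖ₑ ^ 2) x := by
    intro x
    by_cases hx : ∃ i, x ∈ s i
    · obtain ⟨i, hi⟩ := hx
      rw [partAvg_of_mem hd hi, Finset.sum_eq_single i, indicator_of_mem hi]
      · intro j _ hj
        exact indicator_of_notMem (fun hx' => Set.disjoint_left.1 (hd hj) hx' hi) _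
      · simp
    · push Not at hx
      simp [partAvg, hx]
  simp_rw [hpt]
  rw [lintegral_finsetSum _ fun i _ => measurable_const.indicator (hs i)]
  calc ∑ i, ∫⁻ x, (s i).indicator (fun _ => ‖⨍ y in s i, h y ∂μ‖ₑ ^ 2) x ∂μ
      = ∑ i, ‖⨍ y in s i, h y ∂μ‖ₑ ^ 2 * μ (s i) :=
        Finset.sum_congr rfl fun i _ => lintegral_indicator_const (hs i) _
    _ ≤ ∑ i, ∫⁻ y in s i, ‖h y‖ₑ ^ 2 ∂μ :=
        Finset.sum_le_sum fun i _ => enorm_setAverage_sq_mul_le (s i) hh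
    _ = ∫⁻ y in ⋃ i, s i, ‖h y‖ₑ ^ 2 ∂μ := by
        rw [lintegral_iUnion hs hd, tsum_fintype]
    _ ≤ _ := setLIntegral_le_lintegral _ _

end partAvg

/-- Averages over partitions of vanishing mesh converge in `L²`. -/
theorem tendsto_eLpNorm_partAvg_sub {X : Type*} [MetricSpace X] [ProperSpace X]
    [MeasurableSpace X] [BorelSpace X] {μ : Measure X} [IsFiniteMeasure μ] [μ.Regular]
    {ι : ℕ → Type*} [∀ n, Fintype (ι n)] {s : (n : ℕ) → ι n → Set X}
    (hs : ∀ n i, MeasurableSet (s n i)) (hd : ∀ n, Pairwise (Function.onFun Disjoint (s n)))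
    (hcover : ∀ᶠ n in atTop, ∀ᵐ x ∂μ, ∃ i, x ∈ s n i) (hpos : ∀ n i, μ (s n i) ≠ 0)
    (hmesh : ∀ δ : ℝ, 0 < δ → ∀ᶠ n in atTop, ∀ i, ∀ x ∈ s n i, ∀ y ∈ s n i, dist x y < δ)
    {h : X → ℝ} (hh : MemLp h 2 μ) :
    Tendsto (fun n => eLpNorm (partAvg μ (s n) h - h) 2 μ) atTop (𝓝 0) := by
  rw [ENNReal.tendsto_nhds_zero]
  intro ε hε
  have hε3 : ε / 3 ≠ 0 := (ENNReal.div_pos hε.ne' (by norm_num)).ne'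
  -- A compactly supported continuous c is uniformly continuous, so its averages over small cells
  -- are uniformly close to it. The error h - c survives averaging because averaging is an L²
  -- contraction.
  obtain ⟨c, hc_supp, hc_near, hc_cont, hc⟩ :=
    hh.exists_hasCompactSupport_eLpNorm_sub_le (by norm_num) hε3
  have huc := hc_supp.uniformContinuous_of_continuous hc_cont
  obtain ⟨η, hη, hηε⟩ : ∃ η : ℝ, 0 < η ∧ μ univ ^ (1 / 2 : ℝ) * ENNReal.ofReal η ≤ ε / 3 := by
    have ht : Tendsto (fun η : ℝ => μ univ ^ (1 / 2 : ℝ) * ENNReal.ofReal η) (𝓝[>] 0) (𝓝 0) := by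
      have : Tendsto (fun η : ℝ => μ univ ^ (1 / 2 : ℝ) * ENNReal.ofReal η) (𝓝 0)
          (𝓝 (μ univ ^ (1 / 2 : ℝ) * ENNReal.ofReal 0)) :=
        ENNReal.Tendsto.const_mul (ENNReal.continuous_ofReal.tendsto 0)
          (Or.inr (ENNReal.rpow_ne_top_of_nonneg (by norm_num) (measure_ne_top μ univ)))
      simpa using this.mono_left nhdsWithin_le_nhds
    obtain ⟨η, h1, h2⟩ := ((ENNReal.tendsto_nhds_zero.1 ht _ hε3.bot_lt).and
      self_mem_nhdsWithin).exists
    exact ⟨η, h2, h1⟩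
  obtain ⟨δ, hδ, hδη⟩ := Metric.uniformContinuous_iff.1 huc η hη
  filter_upwards [hmesh δ hδ, hcover] with n hn hcov
  have hint : ∀ {k : X → ℝ}, MemLp k 2 μ → Integrable k μ := fun hk => hk.integrable (by norm_num)
  have hsplit : partAvg μ (s n) h - h =
      partAvg μ (s n) (h - c) + (partAvg μ (s n) c - c) + (c - h) := by
    rw [partAvg_sub (hint hh) (hint hc)]
    abel
  have hm : ∀ k, AEStronglyMeasurable (partAvg μ (s n) k) μ :=
    fun k => (measurable_partAvg (hs n) k).aestronglyMeasurable
  have hmid : eLpNorm (partAvg μ (s n) c - c) 2 μ ≤ ε / 3 := by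
    refine le_trans (eLpNorm_le_of_ae_bound (C := η) ?_) (by simpa using hηε)
    filter_upwards [hcov] with x hx
    obtain ⟨i, hi⟩ := hx
    rw [Pi.sub_apply, partAvg_of_mem (hd n) hi]
    have hmem : (⨍ y in s n i, c y ∂μ) ∈ Metric.closedBall (c x) η := by
      refine (convex_closedBall (c x) η).set_average_mem Metric.isClosed_closedBall (hpos n i)
        (measure_ne_top μ _) ?_ (hint hc).integrableOn
      filter_upwards [ae_restrict_mem (hs n i)] with y hy
      exact (hδη (hn i y hy x hi)).le
    simpa [dist_eq_norm] using hmem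
  rw [hsplit]
  calc _ ≤ eLpNorm (partAvg μ (s n) (h - c) + (partAvg μ (s n) c - c)) 2 μ + eLpNorm (c - h) 2 μ :=
        eLpNorm_add_le ((hm _).add ((hm _).sub hc.1)) (hc.1.sub hh.1) (by norm_num)
    _ ≤ eLpNorm (partAvg μ (s n) (h - c)) 2 μ + eLpNorm (partAvg μ (s n) c - c) 2 μ +
          eLpNorm (c - h) 2 μ := by
        gcongr
        exact eLpNorm_add_le (hm _) ((hm _).sub hc.1) (by norm_num)
    _ ≤ ε / 3 + ε / 3 + ε / 3 := by
        gcongr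
        · exact (eLpNorm_partAvg_le (hs n) (hd n) (hh.1.sub hc.1)).trans hc_near
        · rw [eLpNorm_sub_comm]; exact hc_near
    _ = ε := ENNReal.add_thirds ε

/-! ### Cell means, step kernels and truncated kernels. -/

theorem cellMean_eq_setAverage (n : ℕ) (φ : ℝ → ℝ) (i : Fin n) :
    cellMean n φ i = ⨍ x in cell n i, φ x ∂μI := by
  rw [setAverage_eq, measureReal_cell, restrict_cell, cellMean, one_div, inv_inv, smul_eq_mul]

theorem stepFun_cellMean (n : ℕ) (φ : ℝ → ℝ) :
    stepFun n (cellMean n φ) = partAvg μI (cell n) φ := by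
  funext x
  simp only [stepFun, partAvg, cellMean_eq_setAverage]

theorem norm_stepLp_cellMean_le (n : ℕ) (φ : L2I) : ‖stepLp n (cellMean n φ)‖ ≤ ‖φ‖ := by
  rw [Lp.norm_def, Lp.norm_def, eLpNorm_congr_ae (coeFn_stepLp n _), stepFun_cellMean]
  exact ENNReal.toReal_mono (Lp.eLpNorm_ne_top φ)
    (eLpNorm_partAvg_le (measurableSet_cell n) (pairwise_disjoint_cell n)
      (Lp.aestronglyMeasurable φ))

theorem norm_stepLp_cellMean_sub_le (n : ℕ) (φ ψ : L2I) :
    ‖stepLp n (cellMean n φ) - stepLp n (cellMean n ψ)‖ ≤ ‖φ - ψ‖ := by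
  rw [← stepLp_sub, ← cellMean_sub]
  exact norm_stepLp_cellMean_le n _

theorem measure_cell_ne_zero (n : ℕ) (i : Fin n) : μI (cell n i) ≠ 0 := by
  rw [measure_cell]
  simp [i.pos.ne']

theorem ae_exists_mem_cell {n : ℕ} (hn : 0 < n) : ∀ᵐ x ∂μI, ∃ i, x ∈ cell n i := by
  filter_upwards [ae_restrict_mem measurableSet_Icc] with x hx
  exact exists_mem_cell hn hx

theorem tendsto_stepLp_cellMean (φ : L2I) :
    Tendsto (fun n => stepLp n (cellMean n φ)) atTop (𝓝 φ) := by
  have h := tendsto_eLpNorm_partAvg_sub (μ := μI) (s := cell) measurableSet_cell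
    pairwise_disjoint_cell
    ((eventually_gt_atTop 0).mono fun n hn => ae_exists_mem_cell hn) measure_cell_ne_zero
    (fun δ hδ => by
      filter_upwards [tendsto_one_div_atTop_nhds_zero_nat.eventually_lt_const hδ]
        with n hn i x hx y hy
      exact (dist_le_of_mem_cell hx hy).trans_lt hn) (Lp.memLp φ)
  rw [Lp.tendsto_Lp_iff_tendsto_eLpNorm']
  refine h.congr fun n => eLpNorm_congr_ae ?_
  filter_upwards [coeFn_stepLp n (cellMean n φ)] with x hx
  rw [Pi.sub_apply, Pi.sub_apply, hx, stepFun_cellMean]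

/-- The cells of the product mesh of `I²`. -/
def cellProd (n : ℕ) (e : Fin n × Fin n) : Set (ℝ × ℝ) := cell n e.1 ×ˢ cell n e.2

theorem measurableSet_cellProd (n : ℕ) (e : Fin n × Fin n) : MeasurableSet (cellProd n e) :=
  (measurableSet_cell n e.1).prod (measurableSet_cell n e.2)

theorem pairwise_disjoint_cellProd (n : ℕ) :
    Pairwise (Function.onFun Disjoint (cellProd n)) := by
  rintro ⟨i, j⟩ ⟨i', j'⟩ h
  rw [Function.onFun, cellProd, cellProd, Set.disjoint_prod]
  by_cases hi : i = i'
  · exact Or.inr (pairwise_disjoint_cell n fun hj => h (by simp_all))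
  · exact Or.inl (pairwise_disjoint_cell n hi)

theorem prod_restrict_cellProd (n : ℕ) (e : Fin n × Fin n) :
    (μI.prod μI).restrict (cellProd n e) = volume.restrict (cellProd n e) := by
  rw [cellProd, ← Measure.prod_restrict, restrict_cell, restrict_cell, Measure.prod_restrict]
  rfl

theorem measureReal_cellProd (n : ℕ) (e : Fin n × Fin n) :
    (μI.prod μI).real (cellProd n e) = 1 / (n : ℝ) ^ 2 := by
  rw [cellProd, measureReal_prod_prod, measureReal_cell, measureReal_cell]
  ring

theorem cellAvg_eq_setAverage (W : ℝ × ℝ → ℝ) (n : ℕ) (i j : Fin n) :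
    cellAvg W n i j = ⨍ p in cellProd n (i, j), W p ∂(μI.prod μI) := by
  rw [setAverage_eq, measureReal_cellProd, prod_restrict_cellProd, cellAvg, one_div, inv_inv,
    smul_eq_mul, cellProd]

/-- The step kernel with values `⟨W⟩ᵢⱼ`. -/
abbrev stepKernel (n : ℕ) (W : ℝ × ℝ → ℝ) : ℝ × ℝ → ℝ := partAvg (μI.prod μI) (cellProd n) W

theorem stepKernel_of_mem {n : ℕ} {i j : Fin n} {x y : ℝ} (hx : x ∈ cell n i) (hy : y ∈ cell n j)
    (W : ℝ × ℝ → ℝ) : stepKernel n W (x, y) = cellAvg W n i j := by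
  rw [cellAvg_eq_setAverage]
  exact partAvg_of_mem (pairwise_disjoint_cellProd n) (i := (i, j)) (mk_mem_prod hx hy) W

theorem measurable_stepKernel (n : ℕ) (W : ℝ × ℝ → ℝ) : Measurable (stepKernel n W) :=
  measurable_partAvg (measurableSet_cellProd n) W

theorem memLp_stepKernel (n : ℕ) {W : ℝ × ℝ → ℝ} (hW : MemLp W 2 (μI.prod μI)) :
    MemLp (stepKernel n W) 2 (μI.prod μI) :=
  ⟨(measurable_stepKernel n W).aestronglyMeasurable,
    (eLpNorm_partAvg_le (measurableSet_cellProd n) (pairwise_disjoint_cellProd n) hW.1).trans_lt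
      hW.2⟩

theorem tendsto_stepKernel {W : ℝ × ℝ → ℝ} (hW : MemLp W 2 (μI.prod μI)) :
    Tendsto (fun n => eLpNorm (stepKernel n W - W) 2 (μI.prod μI)) atTop (𝓝 0) := by
  refine tendsto_eLpNorm_partAvg_sub measurableSet_cellProd pairwise_disjoint_cellProd
    ?_ ?_ ?_ hW
  · filter_upwards [eventually_gt_atTop 0] with n hn
    have h : ∀ᵐ p ∂(μI.prod μI), p ∈ Icc (0 : ℝ) 1 ×ˢ Icc (0 : ℝ) 1 := by
      rw [Measure.prod_restrict]
      exact ae_restrict_mem (measurableSet_Icc.prod measurableSet_Icc)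
    filter_upwards [h] with p hp
    obtain ⟨i, hi⟩ := exists_mem_cell hn hp.1
    obtain ⟨j, hj⟩ := exists_mem_cell hn hp.2
    exact ⟨(i, j), mk_mem_prod hi hj⟩
  · intro n e
    rw [cellProd, Measure.prod_prod]
    exact mul_ne_zero (measure_cell_ne_zero n _) (measure_cell_ne_zero n _)
  · intro δ hδ
    filter_upwards [tendsto_one_div_atTop_nhds_zero_nat.eventually_lt_const hδ]
      with n hn e x hx y hy
    exact (max_le (dist_le_of_mem_cell hx.1 hy.1) (dist_le_of_mem_cell hx.2 hy.2)).trans_lt hn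

/-- The averaged kernel may itself depend on n, as the truncated graphon of a sparse sequence does;
the contraction property absorbs V n - W. -/
theorem tendsto_stepKernel_of_tendsto {W : ℝ × ℝ → ℝ} {V : ℕ → ℝ × ℝ → ℝ}
    (hW : MemLp W 2 (μI.prod μI)) (hV : ∀ n, MemLp (V n) 2 (μI.prod μI))
    (h : Tendsto (fun n => eLpNorm (V n - W) 2 (μI.prod μI)) atTop (𝓝 0)) :
    Tendsto (fun n => eLpNorm (stepKernel n (V n) - W) 2 (μI.prod μI)) atTop (𝓝 0) := by
  refine tendsto_of_tendsto_of_tendsto_of_le_of_le tendsto_const_nhds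
    (by simpa using h.add (tendsto_stepKernel hW)) (fun _ => zero_le) fun n => ?_
  have hsplit : stepKernel n (V n) - W = stepKernel n (V n - W) + (stepKernel n W - W) := by
    rw [stepKernel, stepKernel, stepKernel, partAvg_sub ((hV n).integrable (by norm_num))
      (hW.integrable (by norm_num))]
    abel
  rw [hsplit]
  refine (eLpNorm_add_le (measurable_stepKernel n _).aestronglyMeasurable
    ((measurable_stepKernel n _).aestronglyMeasurable.sub hW.1) (by norm_num)).trans ?_
  gcongr
  exact eLpNorm_partAvg_le (measurableSet_cellProd n) (pairwise_disjoint_cellProd n)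
    ((hV n).1.sub hW.1)

theorem abs_min_le_abs {c x : ℝ} (hc : 0 ≤ c) : |min c x| ≤ |x| := by
  rcases le_total c x with h | h
  · rw [min_eq_left h, abs_of_nonneg hc]; exact h.trans (le_abs_self x)
  · rw [min_eq_right h]

theorem memLp_min {W : ℝ × ℝ → ℝ} (hW : MemLp W 2 (μI.prod μI)) {c : ℝ} (hc : 0 ≤ c) :
    MemLp (fun p => min c (W p)) 2 (μI.prod μI) :=
  hW.mono (aestronglyMeasurable_const.inf hW.1) (Eventually.of_forall fun _ => abs_min_le_abs hc)

/-- Dominated convergence for the squares: the difference is bounded by |W|, and at each point it is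
0 once the level exceeds W. -/
theorem tendsto_eLpNorm_min_sub {W : ℝ × ℝ → ℝ} (hW : MemLp W 2 (μI.prod μI)) {c : ℕ → ℝ}
    (hc : ∀ n, 0 ≤ c n) (hc_top : Tendsto c atTop atTop) :
    Tendsto (fun n => eLpNorm ((fun p => min (c n) (W p)) - W) 2 (μI.prod μI)) atTop (𝓝 0) := by
  have hsq : Tendsto (fun n => eLpNorm ((fun p => min (c n) (W p)) - W) 2 (μI.prod μI) ^ 2)
      atTop (𝓝 0) := by
    simp only [eLpNorm_two_sq]
    have h := tendsto_lintegral_of_dominated_convergence' (μ := μI.prod μI)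
      (F := fun n p => ‖min (c n) (W p) - W p‖ₑ ^ 2) (f := fun _ => 0)
      (fun p => ‖W p‖ₑ ^ 2) (fun n => ?_) (fun n => ?_) ?_ ?_
    · simpa using h
    · exact (((memLp_min hW (hc n)).1.sub hW.1).enorm).pow_const 2
    · refine Eventually.of_forall fun p => ?_
      have hle : |min (c n) (W p) - W p| ≤ |W p| := by
        have := hc n
        rcases le_total (c n) (W p) with h | h
        · rw [min_eq_left h, abs_le, abs_of_nonneg (this.trans h)]; constructor <;> linarith
        · rw [min_eq_right h]; simp
      exact pow_le_pow_left' (enorm_le_iff_norm_le.2 hle) 2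
    · rw [← eLpNorm_two_sq]
      exact ENNReal.pow_ne_top hW.2.ne
    · refine Eventually.of_forall fun p => tendsto_nhds_of_eventually_eq ?_
      filter_upwards [hc_top.eventually_ge_atTop (W p)] with n hn
      simp [min_eq_right hn]
  rw [ENNReal.tendsto_nhds_zero] at hsq ⊢
  intro ε hε
  filter_upwards [hsq (ε ^ 2) (ENNReal.pow_pos hε 2)] with n hn
  exact (ENNReal.pow_le_pow_left_iff two_ne_zero).1 hn

/-! ### Row and column sums of the cell averages. -/

theorem enorm_cellAvg_le {W V : ℝ × ℝ → ℝ} (hVW : ∀ p, |V p| ≤ |W p|) (n : ℕ) (i j : Fin n) :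
    ‖cellAvg V n i j‖ₑ ≤
      ENNReal.ofReal ((n : ℝ) ^ 2) * ∫⁻ p in cellProd n (i, j), ‖W p‖ₑ ∂(μI.prod μI) := by
  rw [cellAvg, enorm_mul, Real.enorm_of_nonneg (by positivity : (0 : ℝ) ≤ (n : ℝ) ^ 2),
    prod_restrict_cellProd]
  gcongr
  refine (enorm_integral_le_lintegral_enorm _).trans (lintegral_mono fun p => ?_)
  exact enorm_le_iff_norm_le.2 (hVW p)

theorem ofReal_sq_mul_const_mul_measure_cell (n : ℕ) (i : Fin n) (C : ℝ≥0) :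
    ENNReal.ofReal ((n : ℝ) ^ 2) * (C * μI (cell n i)) = ENNReal.ofReal (C * n) := by
  have hn : (n : ℝ) ≠ 0 := by exact_mod_cast i.pos.ne'
  rw [measure_cell, ← ENNReal.ofReal_coe_nnreal, ← ENNReal.ofReal_mul (by positivity),
    ← ENNReal.ofReal_mul (by positivity)]
  congr 1
  field_simp

theorem sum_abs_le_of_sum_enorm_le {ι : Type*} [Fintype ι] {a : ι → ℝ} {r : ℝ} (hr : 0 ≤ r)
    (h : ∑ j, ‖a j‖ₑ ≤ ENNReal.ofReal r) : ∑ j, |a j| ≤ r := by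
  have : ∑ j, ‖a j‖ₑ = ENNReal.ofReal (∑ j, |a j|) := by
    rw [ENNReal.ofReal_sum_of_nonneg fun _ _ => abs_nonneg _]
    exact Finset.sum_congr rfl fun j _ => Real.enorm_eq_ofReal_abs _
  rw [this] at h
  exact (ENNReal.ofReal_le_ofReal_iff hr).1 h

/-- A row sum is at most n² times the integral of |W| over a strip of width 1/n. The kernel V
dominated by W covers a graphon and its truncations at once. -/
theorem sum_row_abs_cellAvg_le {W V : ℝ × ℝ → ℝ} (hW : MemLp W 2 (μI.prod μI)) {C : ℝ≥0}
    (hC : essSup (fun x => ∫⁻ y, ‖W (x, y)‖ₑ ∂μI) μI ≤ C) (hVW : ∀ p, |V p| ≤ |W p|)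
    (n : ℕ) (i : Fin n) : ∑ j, |cellAvg V n i j| ≤ C * n := by
  refine sum_abs_le_of_sum_enorm_le (by positivity) ?_
  calc ∑ j, ‖cellAvg V n i j‖ₑ
      ≤ ∑ j, ENNReal.ofReal ((n : ℝ) ^ 2) * ∫⁻ p in cellProd n (i, j), ‖W p‖ₑ ∂(μI.prod μI) :=
        Finset.sum_le_sum fun j _ => enorm_cellAvg_le hVW n i j
    _ = ENNReal.ofReal ((n : ℝ) ^ 2) *
          ∫⁻ p in ⋃ j, cellProd n (i, j), ‖W p‖ₑ ∂(μI.prod μI) := by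
        rw [← Finset.mul_sum, lintegral_iUnion (fun j => measurableSet_cellProd n (i, j)),
          tsum_fintype]
        exact fun j j' h => pairwise_disjoint_cellProd n fun h' => h (by simpa using h')
    _ ≤ ENNReal.ofReal ((n : ℝ) ^ 2) * ∫⁻ p in cell n i ×ˢ univ, ‖W p‖ₑ ∂(μI.prod μI) := by
        gcongr
        exact iUnion_subset fun j => prod_mono subset_rfl (subset_univ _)
    _ = ENNReal.ofReal ((n : ℝ) ^ 2) * ∫⁻ x in cell n i, ∫⁻ y, ‖W (x, y)‖ₑ ∂μI ∂μI := by
        rw [← Measure.prod_restrict, Measure.restrict_univ, lintegral_prod]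
        refine hW.1.enorm.mono_ac ?_
        exact Measure.AbsolutelyContinuous.prod Measure.restrict_le_self.absolutelyContinuous
          Measure.AbsolutelyContinuous.rfl
    _ ≤ ENNReal.ofReal ((n : ℝ) ^ 2) * ∫⁻ _x in cell n i, C ∂μI := by
        gcongr 1
        refine lintegral_mono_ae (ae_restrict_of_ae ?_)
        filter_upwards [ae_le_essSup (f := fun x => ∫⁻ y, ‖W (x, y)‖ₑ ∂μI) (μ := μI)] with x hx
        exact hx.trans hC
    _ = ENNReal.ofReal (C * n) := by
        rw [setLIntegral_const, ofReal_sq_mul_const_mul_measure_cell]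

theorem cellAvg_swap (V : ℝ × ℝ → ℝ) (n : ℕ) (i j : Fin n) :
    cellAvg (V ∘ Prod.swap) n i j = cellAvg V n j i := by
  rw [cellAvg, cellAvg]
  congr 1
  exact setIntegral_prod_swap (μ := (volume : Measure ℝ)) (ν := (volume : Measure ℝ)) _ _ V

theorem sum_col_abs_cellAvg_le {W V : ℝ × ℝ → ℝ} (hW : MemLp W 2 (μI.prod μI)) {C : ℝ≥0}
    (hC : essSup (fun y => ∫⁻ x, ‖W (x, y)‖ₑ ∂μI) μI ≤ C) (hVW : ∀ p, |V p| ≤ |W p|)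
    (n : ℕ) (j : Fin n) : ∑ i, |cellAvg V n i j| ≤ C * n := by
  simp only [← cellAvg_swap V n j]
  exact sum_row_abs_cellAvg_le (W := W ∘ Prod.swap)
    (hW.comp_measurePreserving Measure.measurePreserving_swap) hC (fun p => hVW p.swap) n j

/-! ### The interaction operator: Lipschitz bound and consistency. -/

/-- The vector field `i ↦ n⁻¹ ∑ⱼ aᵢⱼ D(φⱼ - φᵢ)` of a network with weights `aᵢⱼ`. -/
def interaction (n : ℕ) (a : Fin n → Fin n → ℝ) (D : ℝ → ℝ) (φ : Fin n → ℝ) (i : Fin n) : ℝ :=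
  1 / n * ∑ j, a i j * D (φ j - φ i)

theorem interaction_sub_weights (n : ℕ) (a b : Fin n → Fin n → ℝ) (D : ℝ → ℝ) (φ : Fin n → ℝ) :
    interaction n (a - b) D φ = interaction n a D φ - interaction n b D φ := by
  funext i
  simp only [interaction, Pi.sub_apply, sub_mul, Finset.sum_sub_distrib, mul_sub]

/-- Schur test: Cauchy–Schwarz with weights |a i j| leaves a row sum as one factor; in the other,
the terms δ j ^ 2 are summed through columns and the terms δ i ^ 2 through rows. -/
theorem norm_stepLp_interaction_sub_le {n : ℕ} {a : Fin n → Fin n → ℝ} {D : ℝ → ℝ} {L : ℝ≥0}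
    (hD : LipschitzWith L D) {R : ℝ} (hR : 0 ≤ R) (hrow : ∀ i, ∑ j, |a i j| ≤ R * n)
    (hcol : ∀ j, ∑ i, |a i j| ≤ R * n) (φ ψ : Fin n → ℝ) :
    ‖stepLp n (interaction n a D φ) - stepLp n (interaction n a D ψ)‖ ≤
      2 * L * R * ‖stepLp n φ - stepLp n ψ‖ := by
  rw [← stepLp_sub, ← stepLp_sub]
  refine norm_stepLp_le_of_sq_le (by positivity) ?_
  rcases Nat.eq_zero_or_pos n with rfl | hn
  · simp
  have hn' : (0 : ℝ) < n := by exact_mod_cast hn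
  set δ := φ - ψ with hδ
  have hterm : ∀ i, (interaction n a D φ - interaction n a D ψ) i ^ 2 ≤
      2 * L ^ 2 * R / n * ∑ j, |a i j| * (δ j ^ 2 + δ i ^ 2) := by
    intro i
    have habs : |∑ j, a i j * (D (φ j - φ i) - D (ψ j - ψ i))| ≤
        L * ∑ j, |a i j| * (|δ j| + |δ i|) := by
      refine (Finset.abs_sum_le_sum_abs _ _).trans ?_
      rw [Finset.mul_sum]
      refine Finset.sum_le_sum fun j _ => ?_
      rw [abs_mul, mul_left_comm]
      gcongr
      have h1 := hD.dist_le_mul (φ j - φ i) (ψ j - ψ i)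
      rw [Real.dist_eq, Real.dist_eq] at h1
      refine h1.trans ?_
      gcongr
      have h2 : φ j - φ i - (ψ j - ψ i) = δ j - δ i := by simp only [hδ, Pi.sub_apply]; ring
      rw [h2]
      exact abs_sub _ _
    have hcs : (∑ j, |a i j| * (|δ j| + |δ i|)) ^ 2 ≤
        (∑ j, |a i j|) * ∑ j, |a i j| * (2 * (δ j ^ 2 + δ i ^ 2)) := by
      refine Finset.sum_sq_le_sum_mul_sum_of_sq_le_mul _ (fun j _ => abs_nonneg _)
        (fun j _ => by positivity) fun j _ => ?_
      rw [mul_pow, sq |a i j|, mul_assoc]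
      gcongr
      nlinarith [sq_nonneg (|δ j| - |δ i|), sq_abs (δ j), sq_abs (δ i)]
    have heq : (interaction n a D φ - interaction n a D ψ) i =
        1 / n * ∑ j, a i j * (D (φ j - φ i) - D (ψ j - ψ i)) := by
      simp only [interaction, Pi.sub_apply, mul_sub, Finset.sum_sub_distrib]
    calc _ = (1 / (n : ℝ)) ^ 2 * |∑ j, a i j * (D (φ j - φ i) - D (ψ j - ψ i))| ^ 2 := by
          rw [heq, mul_pow, sq_abs]
      _ ≤ (1 / (n : ℝ)) ^ 2 * (L * ∑ j, |a i j| * (|δ j| + |δ i|)) ^ 2 := by gcongr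
      _ ≤ (1 / (n : ℝ)) ^ 2 * (L ^ 2 *
            ((R * n) * ∑ j, |a i j| * (2 * (δ j ^ 2 + δ i ^ 2)))) := by
          rw [mul_pow]
          gcongr
          exact hcs.trans (mul_le_mul_of_nonneg_right (hrow i)
            (Finset.sum_nonneg fun j _ => by positivity))
      _ = _ := by
          simp only [mul_left_comm _ (2 : ℝ), ← Finset.mul_sum]
          field_simp
  refine (Finset.sum_le_sum fun i _ => hterm i).trans ?_
  rw [← Finset.mul_sum]
  have h1 : ∑ i, ∑ j, |a i j| * δ j ^ 2 ≤ R * n * ∑ j, δ j ^ 2 := by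
    rw [Finset.sum_comm, Finset.mul_sum]
    refine Finset.sum_le_sum fun j _ => ?_
    rw [← Finset.sum_mul]
    gcongr
    exact hcol j
  have h2 : ∑ i, ∑ j, |a i j| * δ i ^ 2 ≤ R * n * ∑ j, δ j ^ 2 := by
    rw [Finset.mul_sum]
    refine Finset.sum_le_sum fun i _ => ?_
    rw [← Finset.sum_mul]
    gcongr
    exact hrow i
  calc _ ≤ 2 * L ^ 2 * R / n * (R * n * ∑ j, δ j ^ 2 + R * n * ∑ j, δ j ^ 2) := by
        simp only [mul_add, Finset.sum_add_distrib]
        rw [← mul_add, ← mul_add]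
        gcongr
    _ = _ := by field_simp; ring

/-- The Hilbert–Schmidt bound: Cauchy–Schwarz in y for almost every x, then integration in x. -/
theorem eLpNorm_integral_abs_mul_le {a : ℝ × ℝ → ℝ} {b : ℝ → ℝ} (ha : MemLp a 2 (μI.prod μI))
    (hb : MemLp b 2 μI) :
    eLpNorm (fun x => ∫ y, |a (x, y)| * |b y| ∂μI) 2 μI ≤
      eLpNorm a 2 (μI.prod μI) * eLpNorm b 2 μI := by
  refine (ENNReal.pow_le_pow_left_iff two_ne_zero).1 ?_
  rw [mul_pow, eLpNorm_two_sq, eLpNorm_two_sq, eLpNorm_two_sq,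
    lintegral_prod _ (ha.1.enorm.pow_const 2), ← lintegral_mul_const' _ _ ?_]
  · refine lintegral_mono_ae ?_
    filter_upwards [ha.1.prodMk_left] with x hx
    calc ‖∫ y, |a (x, y)| * |b y| ∂μI‖ₑ ^ 2 ≤ (∫⁻ y, ‖a (x, y)‖ₑ * ‖b y‖ₑ ∂μI) ^ 2 := by
          gcongr
          refine (enorm_integral_le_lintegral_enorm _).trans_eq ?_
          simp [enorm_mul]
      _ ≤ _ := lintegral_mul_sq_le μI hx.enorm hb.1.enorm
  · rw [← eLpNorm_two_sq]
    exact ENNReal.pow_ne_top hb.2.ne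

theorem memLp_integral_abs_mul {a : ℝ × ℝ → ℝ} {b : ℝ → ℝ} (ha : MemLp a 2 (μI.prod μI))
    (hb : MemLp b 2 μI) : MemLp (fun x => ∫ y, |a (x, y)| * |b y| ∂μI) 2 μI := by
  refine ⟨?_, (eLpNorm_integral_abs_mul_le ha hb).trans_lt (ENNReal.mul_lt_top ha.2 hb.2)⟩
  exact (ha.1.norm.mul hb.1.comp_snd.norm).integral_prod_right'

theorem exists_lp_integral_abs_mul {a : ℝ × ℝ → ℝ} {b : ℝ → ℝ} (ha : MemLp a 2 (μI.prod μI))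
    (hb : MemLp b 2 μI) : ∃ Q : L2I, (Q =ᵐ[μI] fun x => ∫ y, |a (x, y)| * |b y| ∂μI) ∧
      ‖Q‖ ≤ (eLpNorm a 2 (μI.prod μI)).toReal * (eLpNorm b 2 μI).toReal := by
  refine ⟨(memLp_integral_abs_mul ha hb).toLp _, MemLp.coeFn_toLp _, ?_⟩
  rw [Lp.norm_toLp, ← ENNReal.toReal_mul]
  exact ENNReal.toReal_mono (ENNReal.mul_lt_top ha.2 hb.2).ne (eLpNorm_integral_abs_mul_le ha hb)

theorem interaction_eq_integral {n : ℕ} (V : ℝ × ℝ → ℝ) (D : ℝ → ℝ) (φ : Fin n → ℝ) {i : Fin n}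
    {x : ℝ} (hx : x ∈ cell n i) :
    interaction n (cellAvg V n) D φ i =
      ∫ y, stepKernel n V (x, y) * D (stepFun n φ y - stepFun n φ x) ∂μI := by
  rw [interaction, ← integral_stepFun]
  refine integral_congr_ae ?_
  filter_upwards [ae_exists_mem_cell i.pos] with y hy
  obtain ⟨j, hj⟩ := hy
  rw [stepFun_of_mem hj, stepFun_of_mem hj, stepFun_of_mem hx, stepKernel_of_mem hx hj]

/-- The interaction operator with averaged kernel and data is close to the continuum one. -/
theorem exists_interaction_sub_integral_le {W V : ℝ × ℝ → ℝ} (hW : MemLp W 2 (μI.prod μI))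
    (hV : MemLp V 2 (μI.prod μI)) {C : ℝ≥0}
    (hC : essSup (fun x => ∫⁻ y, ‖W (x, y)‖ₑ ∂μI) μI ≤ C)
    {D : ℝ → ℝ} {L : ℝ≥0} (hL : LipschitzWith L D) {B : ℝ} (hB : ∀ x, |D x| ≤ B)
    {n : ℕ} (hn : 0 < n) (φ : L2I) :
    ∃ Q : L2I, ‖Q‖ ≤ B * (eLpNorm (stepKernel n V - W) 2 (μI.prod μI)).toReal +
        L * ((eLpNorm W 2 (μI.prod μI)).toReal + C) * ‖stepLp n (cellMean n φ) - φ‖ ∧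
      ∀ᵐ x ∂μI, |stepFun n (interaction n (cellAvg V n) D (cellMean n φ)) x -
        ∫ y, W (x, y) * D (φ y - φ x) ∂μI| ≤ Q x := by
  have hB0 : 0 ≤ B := (abs_nonneg _).trans (hB 0)
  set δ : L2I := stepLp n (cellMean n φ) - φ with hδ_def
  set s := stepFun n (cellMean n φ) with hs_def
  have hδ : ∀ᵐ x ∂μI, δ x = s x - φ x := by
    filter_upwards [Lp.coeFn_sub (stepLp n (cellMean n φ)) φ, coeFn_stepLp n (cellMean n φ)]
      with x h1 h2
    rw [h1, Pi.sub_apply, h2]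
  have hK := memLp_stepKernel n hV
  obtain ⟨Q₁, hQ₁, hQ₁n⟩ := exists_lp_integral_abs_mul (hK.sub hW) (memLp_const (1 : ℝ))
  obtain ⟨Q₂, hQ₂, hQ₂n⟩ := exists_lp_integral_abs_mul hW (Lp.memLp δ)
  have h1n : (eLpNorm (fun _ : ℝ => (1 : ℝ)) 2 μI).toReal = 1 := by
    rw [eLpNorm_const' _ (by norm_num) (by norm_num)]
    simp
  rw [h1n, mul_one] at hQ₁n
  -- With K the step kernel and s the averaged φ, the error splits as (K - W) D(s y - s x) + W (D(s
  -- y - s x) - D(φ y - φ x)). The first term gives `Q₁`; the increments of δ = s - φ at y and at x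
  -- give `Q₂` and the term in |δ|.
  refine ⟨B • Q₁ + (L : ℝ) • Q₂ + ((L : ℝ) * C) • |δ|, ?_, ?_⟩
  · calc _ ≤ ‖B • Q₁‖ + ‖(L : ℝ) • Q₂‖ + ‖((L : ℝ) * C) • |δ|‖ := norm_add₃_le
      _ = B * ‖Q₁‖ + L * ‖Q₂‖ + L * C * ‖δ‖ := by
          rw [norm_smul, norm_smul, norm_smul, norm_abs_eq_norm, Real.norm_of_nonneg hB0,
            Real.norm_of_nonneg L.coe_nonneg, Real.norm_of_nonneg (by positivity)]
      _ ≤ B * (eLpNorm (stepKernel n V - W) 2 (μI.prod μI)).toReal +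
            L * ((eLpNorm W 2 (μI.prod μI)).toReal * ‖δ‖) + L * C * ‖δ‖ := by
          gcongr
          rwa [← Lp.norm_def] at hQ₂n
      _ = _ := by ring
  · have hWi : Integrable W (μI.prod μI) := hW.integrable (by norm_num)
    have hKi : Integrable (stepKernel n V) (μI.prod μI) := hK.integrable (by norm_num)
    have hWδ : Integrable (fun p : ℝ × ℝ => W p * δ p.2) (μI.prod μI) :=
      hW.integrable_mul ((Lp.memLp δ).comp_snd μI)
    have hDc : Continuous D := hL.continuous
    filter_upwards [ae_exists_mem_cell hn, hδ, hQ₁, hQ₂, hWi.prod_right_ae, hKi.prod_right_ae,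
      hWδ.prod_right_ae, ae_le_essSup (f := fun x => ∫⁻ y, ‖W (x, y)‖ₑ ∂μI) (μ := μI),
      Lp.coeFn_add (B • Q₁ + (L : ℝ) • Q₂) (((L : ℝ) * C) • |δ|),
      Lp.coeFn_add (B • Q₁) ((L : ℝ) • Q₂), Lp.coeFn_smul B Q₁, Lp.coeFn_smul (L : ℝ) Q₂,
      Lp.coeFn_smul ((L : ℝ) * C) |δ|, Lp.coeFn_abs δ]
      with x hx hδx h1 h2 hWx hKx hWδx hess e1 e2 e3 e4 e5 e6
    obtain ⟨i, hi⟩ := hx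
    rw [stepFun_of_mem hi, interaction_eq_integral V D _ hi, e1, Pi.add_apply, e2, Pi.add_apply,
      e3, e4, e5, Pi.smul_apply, Pi.smul_apply, Pi.smul_apply, e6, h1, h2]
    simp only [smul_eq_mul, ← hs_def]
    have hms : AEStronglyMeasurable s μI := (measurable_stepFun n _).aestronglyMeasurable
    have hmφ : AEStronglyMeasurable φ μI := Lp.aestronglyMeasurable φ
    have hI1 : Integrable (fun y => stepKernel n V (x, y) * D (s y - s x)) μI :=
      hKx.mul_bdd (c := B) (hDc.comp_aestronglyMeasurable (hms.sub aestronglyMeasurable_const))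
        (Eventually.of_forall fun y => hB _)
    have hI2 : Integrable (fun y => W (x, y) * D (φ y - φ x)) μI :=
      hWx.mul_bdd (c := B) (hDc.comp_aestronglyMeasurable (hmφ.sub aestronglyMeasurable_const))
        (Eventually.of_forall fun y => hB _)
    have hWC : ∫ y, |W (x, y)| ∂μI ≤ C := by
      have := hess.trans hC
      have h := integral_norm_eq_lintegral_enorm hWx.1
      simp only [Real.norm_eq_abs] at h
      rw [h]
      exact ENNReal.toReal_le_coe_of_le_coe this
    have hJ1 : Integrable (fun y => B * (|(stepKernel n V - W) (x, y)| * |(1 : ℝ)|)) μI := by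
      simpa using ((hKx.sub hWx).abs).const_mul B
    have hJ2 : Integrable (fun y => L * (|W (x, y)| * |δ y|)) μI := by
      simpa [abs_mul] using hWδx.abs.const_mul (L : ℝ)
    have hJ3 : Integrable (fun y => L * |δ x| * |W (x, y)|) μI := hWx.abs.const_mul _
    have hJ12 : Integrable (fun y => B * (|(stepKernel n V - W) (x, y)| * |(1 : ℝ)|) +
        L * (|W (x, y)| * |δ y|)) μI := hJ1.add hJ2
    rw [← integral_sub hI1 hI2]
    calc |∫ y, (stepKernel n V (x, y) * D (s y - s x) - W (x, y) * D (φ y - φ x)) ∂μI|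
        ≤ ∫ y, (B * (|(stepKernel n V - W) (x, y)| * |(1 : ℝ)|) + L * (|W (x, y)| * |δ y|) +
            L * |δ x| * |W (x, y)|) ∂μI := by
          rw [← Real.norm_eq_abs]
          refine norm_integral_le_of_norm_le (hJ12.add hJ3) ?_
          filter_upwards [hδ] with y hδy
          have hd : |D (s y - s x) - D (φ y - φ x)| ≤ L * (|δ y| + |δ x|) := by
            have h3 := hL.dist_le_mul (s y - s x) (φ y - φ x)
            rw [Real.dist_eq, Real.dist_eq] at h3
            refine h3.trans ?_
            gcongr
            have h4 : s y - s x - (φ y - φ x) = δ y - δ x := by rw [hδy, hδx]; ring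
            rw [h4]
            exact abs_sub _ _
          have h5 : stepKernel n V (x, y) * D (s y - s x) - W (x, y) * D (φ y - φ x) =
              (stepKernel n V - W) (x, y) * D (s y - s x) +
                W (x, y) * (D (s y - s x) - D (φ y - φ x)) := by
            rw [Pi.sub_apply]; ring
          rw [Real.norm_eq_abs, h5]
          refine (abs_add_le _ _).trans ?_
          rw [abs_mul, abs_mul]
          have h6 := mul_le_mul_of_nonneg_left (hB (s y - s x))
            (abs_nonneg ((stepKernel n V - W) (x, y)))
          have h7 := mul_le_mul_of_nonneg_left hd (abs_nonneg (W (x, y)))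
          rw [abs_one]
          linarith
      _ = B * ∫ y, |(stepKernel n V - W) (x, y)| * |(1 : ℝ)| ∂μI +
            L * ∫ y, |W (x, y)| * |δ y| ∂μI + L * |δ x| * ∫ y, |W (x, y)| ∂μI := by
          rw [integral_add hJ12 hJ3, integral_add hJ1 hJ2, integral_const_mul,
            integral_const_mul, integral_const_mul]
      _ ≤ B * ∫ y, |(stepKernel n V - W) (x, y)| * |(1 : ℝ)| ∂μI +
            L * ∫ y, |W (x, y)| * |δ y| ∂μI + L * |δ x| * C := by gcongr
      _ = _ := by ring

/-- Consistency of the averaged network equation with the continuum equation. -/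
theorem norm_averaged_field_sub_le {m : ℕ} {F : ℝ → ℝ} {LF : ℝ≥0} (hF : LipschitzWith LF F)
    {D : Fin m → ℝ → ℝ} {L : Fin m → ℝ≥0} (hL : ∀ k, LipschitzWith (L k) (D k)) {B : Fin m → ℝ}
    (hB : ∀ k x, |D k x| ≤ B k) {W V : Fin m → ℝ × ℝ → ℝ}
    (hW : ∀ k, MemLp (W k) 2 (μI.prod μI)) (hV : ∀ k, MemLp (V k) 2 (μI.prod μI)) {C : ℝ≥0}
    (hC : ∀ k, essSup (fun x => ∫⁻ y, ‖W k (x, y)‖ₑ ∂μI) μI ≤ C) {n : ℕ} (hn : 0 < n)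
    {φ ψ : L2I}
    (hψ : ψ =ᵐ[μI] fun x => F (φ x) + ∑ k, ∫ y, W k (x, y) * D k (φ y - φ x) ∂μI) :
    ‖stepLp n (fun i => F (cellMean n φ i) +
        ∑ k, interaction n (cellAvg (V k) n) (D k) (cellMean n φ) i) - ψ‖ ≤
      ∑ k, B k * (eLpNorm (stepKernel n (V k) - W k) 2 (μI.prod μI)).toReal +
      (LF + ∑ k, L k * ((eLpNorm (W k) 2 (μI.prod μI)).toReal + C)) *
        ‖stepLp n (cellMean n φ) - φ‖ := by
  choose Q hQn hQ using fun k =>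
    exists_interaction_sub_integral_le (hW k) (hV k) (hC k) (hL k) (hB k) hn φ
  set δ : L2I := stepLp n (cellMean n φ) - φ with hδ_def
  have hle : ‖stepLp n (fun i => F (cellMean n φ i) +
        ∑ k, interaction n (cellAvg (V k) n) (D k) (cellMean n φ) i) - ψ‖ ≤
      ‖(LF : ℝ) • |δ| + ∑ k, Q k‖ := by
    refine Lp.norm_le_norm_of_ae_le ?_
    filter_upwards [ae_exists_mem_cell hn, Lp.coeFn_sub (stepLp n (cellMean n φ)) φ,
      coeFn_stepLp n (cellMean n φ), hψ, ae_all_iff.2 hQ,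
      Lp.coeFn_sub (stepLp n (fun i => F (cellMean n φ i) +
        ∑ k, interaction n (cellAvg (V k) n) (D k) (cellMean n φ) i)) ψ,
      coeFn_stepLp n (fun i => F (cellMean n φ i) +
        ∑ k, interaction n (cellAvg (V k) n) (D k) (cellMean n φ) i),
      Lp.coeFn_add ((LF : ℝ) • |δ|) (∑ k, Q k), Lp.coeFn_smul (LF : ℝ) |δ|, Lp.coeFn_abs δ,
      Lp.coeFn_fun_finsetSum Finset.univ Q]
      with x hx e1 e2 hψx hQx e3 e4 e5 e6 e7 e8
    obtain ⟨i, hi⟩ := hx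
    have hδx : δ x = cellMean n φ i - φ x := by
      rw [hδ_def, e1, Pi.sub_apply, e2, stepFun_of_mem hi]
    have h1 : |F (cellMean n φ i) - F (φ x)| ≤ LF * |δ x| := by
      rw [hδx]
      simpa [Real.dist_eq] using hF.dist_le_mul (cellMean n φ i) (φ x)
    have h2 : ∀ k, |interaction n (cellAvg (V k) n) (D k) (cellMean n φ) i -
        ∫ y, W k (x, y) * D k (φ y - φ x) ∂μI| ≤ Q k x := by
      intro k
      have := hQx k
      rwa [stepFun_of_mem hi] at this
    rw [e3, Pi.sub_apply, e4, stepFun_of_mem hi, hψx, e5, Pi.add_apply, e6, Pi.smul_apply, e7, e8,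
      smul_eq_mul, Real.norm_eq_abs, Real.norm_eq_abs, add_sub_add_comm, ← Finset.sum_sub_distrib]
    refine le_trans ?_ (le_abs_self _)
    refine (abs_add_le _ _).trans (add_le_add h1 ((Finset.abs_sum_le_sum_abs _ _).trans ?_))
    exact Finset.sum_le_sum fun k _ => h2 k
  refine hle.trans ((norm_add_le _ _).trans ?_)
  rw [norm_smul, norm_abs_eq_norm, Real.norm_of_nonneg LF.coe_nonneg]
  have h3 := (norm_sum_le Finset.univ Q).trans (Finset.sum_le_sum fun k _ => hQn k)
  rw [Finset.sum_add_distrib, ← Finset.sum_mul] at h3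
  linarith

/-! ### Concentration of weighted Bernoulli sums. -/

section probability

variable {Ω : Type*} [MeasurableSpace Ω] {P : Measure Ω} [IsProbabilityMeasure P]

/-- With b = t a, use exp b - 1 ≤ b + b² for |b| ≤ 1 and 1 + x ≤ exp x; centring cancels the linear
term. The exponent stays proportional to p, which matters when p is small. -/
theorem mgf_bernoulli_sub_le {w : Ω → ℝ} (hm : Measurable w) (h01 : ∀ ω, w ω = 0 ∨ w ω = 1)
    {p : ℝ} (hp : 0 ≤ p) (hP : P {ω | w ω = 1} = ENNReal.ofReal p) {a t : ℝ} (hat : |t * a| ≤ 1) :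
    mgf (fun ω => a * (w ω - p)) P t ≤ Real.exp ((t * a) ^ 2 * p) := by
  set b := t * a with hb
  have hS : MeasurableSet {ω | w ω = 1} := hm (measurableSet_singleton 1)
  have hpt : ∀ ω, Real.exp (t * (a * (w ω - p))) =
      Real.exp (-(b * p)) * (1 + {ω | w ω = 1}.indicator (fun _ => Real.exp b - 1) ω) := by
    intro ω
    have h1 : t * (a * (w ω - p)) = -(b * p) + b * w ω := by rw [hb]; ring
    rw [h1, Real.exp_add]
    rcases h01 ω with h | h <;> simp [indicator, h]
  have hint : mgf (fun ω => a * (w ω - p)) P t =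
      Real.exp (-(b * p)) * (1 + p * (Real.exp b - 1)) := by
    simp only [mgf, hpt]
    rw [integral_const_mul, integral_add (integrable_const _)
      ((integrable_const _).indicator hS), integral_indicator_const _ hS, measureReal_def, hP,
      ENNReal.toReal_ofReal hp]
    simp
  have hexp : Real.exp b - 1 ≤ b + b ^ 2 := by
    have := (abs_le.1 (Real.abs_exp_sub_one_sub_id_le hat)).2
    linarith
  rw [hint]
  calc Real.exp (-(b * p)) * (1 + p * (Real.exp b - 1))
      ≤ Real.exp (-(b * p)) * Real.exp (p * (b + b ^ 2)) := by
        gcongr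
        have h1 : p * (Real.exp b - 1) ≤ p * (b + b ^ 2) := by gcongr
        linarith [Real.add_one_le_exp (p * (b + b ^ 2))]
    _ = Real.exp (b ^ 2 * p) := by rw [← Real.exp_add]; ring_nf

/-- Chernoff's bound. The quadratic term carries ∑ p rather than the number of summands, as a
Hoeffding bound would; in a sparse row ∑ p is only of order n α. -/
theorem measureReal_le_sum_bernoulli_sub {ι : Type*} [Fintype ι] {w : ι → Ω → ℝ}
    (hm : ∀ j, Measurable (w j)) (h01 : ∀ j ω, w j ω = 0 ∨ w j ω = 1) {p : ι → ℝ}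
    (hp : ∀ j, 0 ≤ p j) (hP : ∀ j, P {ω | w j ω = 1} = ENNReal.ofReal (p j))
    (hind : iIndepFun w P) {a : ι → ℝ} {B t r : ℝ} (ht : 0 ≤ t) (htB : t * B ≤ 1)
    (ha : ∀ j, |a j| ≤ B) :
    P.real {ω | r ≤ ∑ j, a j * (w j ω - p j)} ≤ Real.exp (-t * r + t ^ 2 * B ^ 2 * ∑ j, p j) := by
  have hta : ∀ j, |t * a j| ≤ t * B := fun j => by
    rw [abs_mul, abs_of_nonneg ht]; exact mul_le_mul_of_nonneg_left (ha j) ht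
  set X : ι → Ω → ℝ := fun j ω => a j * (w j ω - p j) with hX
  have hXm : ∀ j, Measurable (X j) := fun j => ((hm j).sub_const _).const_mul _
  have hXind : iIndepFun X P :=
    hind.comp (fun j y => a j * (y - p j)) fun j => (measurable_id.sub_const _).const_mul _
  have hXb : ∀ j ω, |X j ω| ≤ |a j| * (1 + p j) := by
    intro j ω
    rw [hX, abs_mul]
    gcongr
    rcases h01 j ω with h | h
    · rw [h, zero_sub, abs_neg, abs_of_nonneg (hp j)]; linarith
    · rw [h, abs_le]; constructor <;> linarith [hp j]
  have hint : Integrable (fun ω => Real.exp (t * (∑ j, X j) ω)) P := by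
    refine Integrable.of_bound (C := Real.exp (t * ∑ j, |a j| * (1 + p j))) ?_ ?_
    · simp only [Finset.sum_apply]
      exact (Real.measurable_exp.comp ((Finset.measurable_fun_sum _ fun j _ => hXm j).const_mul
        t)).aestronglyMeasurable
    · refine Eventually.of_forall fun ω => ?_
      rw [Real.norm_eq_abs, Real.abs_exp, Finset.sum_apply]
      gcongr
      exact (le_abs_self _).trans (hXb _ ω)
  have h := measure_ge_le_exp_mul_mgf (μ := P) (X := ∑ j, X j) r ht hint
  simp only [Finset.sum_apply] at h
  refine h.trans ?_
  rw [hXind.mgf_sum hXm, Real.exp_add]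
  gcongr
  rw [Finset.mul_sum, Real.exp_sum]
  refine Finset.prod_le_prod (fun j _ => mgf_nonneg) fun j _ => ?_
  refine (mgf_bernoulli_sub_le (hm j) (h01 j) (hp j) (hP j) ((hta j).trans htB)).trans ?_
  have : (t * a j) ^ 2 ≤ t ^ 2 * B ^ 2 := by
    rw [← mul_pow]; exact sq_le_sq.2 ((hta j).trans (le_abs_self _))
  gcongr
  exact hp j

theorem measureReal_le_abs_sum_bernoulli_sub {ι : Type*} [Fintype ι] {w : ι → Ω → ℝ}
    (hm : ∀ j, Measurable (w j)) (h01 : ∀ j ω, w j ω = 0 ∨ w j ω = 1) {p : ι → ℝ}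
    (hp : ∀ j, 0 ≤ p j) (hP : ∀ j, P {ω | w j ω = 1} = ENNReal.ofReal (p j))
    (hind : iIndepFun w P) {a : ι → ℝ} {B t r : ℝ} (ht : 0 ≤ t) (htB : t * B ≤ 1)
    (ha : ∀ j, |a j| ≤ B) :
    P.real {ω | r ≤ |∑ j, a j * (w j ω - p j)|} ≤
      2 * Real.exp (-t * r + t ^ 2 * B ^ 2 * ∑ j, p j) := by
  have h1 := measureReal_le_sum_bernoulli_sub hm h01 hp hP hind (r := r) ht htB ha
  have h2 := measureReal_le_sum_bernoulli_sub hm h01 hp hP hind (r := r) (a := fun j => -a j) ht htB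
    (fun j => by rw [abs_neg]; exact ha j)
  have hsub : {ω | r ≤ |∑ j, a j * (w j ω - p j)|} ⊆ {ω | r ≤ ∑ j, a j * (w j ω - p j)} ∪
      {ω | r ≤ ∑ j, -a j * (w j ω - p j)} := by
    intro ω hω
    have hω' : r ≤ |∑ j, a j * (w j ω - p j)| := hω
    rcases le_abs.1 hω' with h | h
    · exact Or.inl h
    · refine Or.inr ?_
      change r ≤ ∑ j, -a j * (w j ω - p j)
      simpa only [neg_mul, Finset.sum_neg_distrib] using h
  calc _ ≤ _ := measureReal_mono hsub
    _ ≤ _ := measureReal_union_le _ _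
    _ ≤ _ := by linarith

theorem summable_mul_exp_neg_rpow {c β : ℝ} (hc : 0 < c) (hβ : 0 < β) :
    Summable fun n : ℕ => (n : ℝ) * (2 * Real.exp (-c * (n : ℝ) ^ β)) := by
  -- The power -3/β turns n^β into n^{-3}, so the extra factor n still leaves the summable n^{-2}.
  have h1 : (fun n : ℕ => Real.exp (-c * (n : ℝ) ^ β)) =o[atTop]
      fun n : ℕ => ((n : ℝ) ^ β) ^ (-3 / β) :=
    (isLittleO_exp_neg_mul_rpow_atTop hc (-3 / β)).comp_tendsto
      ((tendsto_rpow_atTop hβ).comp tendsto_natCast_atTop_atTop)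
  have h2 : (fun n : ℕ => (n : ℝ) * (2 * Real.exp (-c * (n : ℝ) ^ β))) =O[atTop]
      fun n : ℕ => (n : ℝ) * ((n : ℝ) ^ β) ^ (-3 / β) :=
    (Asymptotics.isBigO_refl _ _).mul (h1.isBigO.const_mul_left 2)
  have h3 : (fun n : ℕ => (n : ℝ) * ((n : ℝ) ^ β) ^ (-3 / β)) =ᶠ[atTop]
      fun n : ℕ => (n : ℝ) ^ (-2 : ℝ) := by
    filter_upwards [eventually_gt_atTop 0] with n hn
    have hn' : (0 : ℝ) < n := by exact_mod_cast hn
    rw [← Real.rpow_mul hn'.le, mul_div_cancel₀ _ hβ.ne']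
    nth_rw 1 [← Real.rpow_one (n : ℝ)]
    rw [← Real.rpow_add hn']
    norm_num
  exact summable_of_isBigO_nat (Real.summable_nat_rpow.2 (by norm_num)) (h2.trans h3.isBigO)

/-- Weighted row sums of an array of Bernoulli variables, independent in each row, are almost
surely uniformly close to their means. -/
theorem ae_tendsto_rows_bernoulli {γ : ℝ} (hγ : γ < 1) {w : (n : ℕ) → Fin n → Fin n → Ω → ℝ}
    (hm : ∀ n i j, Measurable (w n i j)) (h01 : ∀ n i j ω, w n i j ω = 0 ∨ w n i j ω = 1)
    {p : (n : ℕ) → Fin n → Fin n → ℝ} (hp : ∀ n i j, 0 ≤ p n i j)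
    (hP : ∀ n i j, P {ω | w n i j ω = 1} = ENNReal.ofReal (p n i j))
    (hind : ∀ n i, iIndepFun (w n i) P) {C : ℝ}
    (hpC : ∀ n i, ∑ j, p n i j ≤ C * (n * scaling γ n))
    {a : (n : ℕ) → Fin n → Fin n → ℝ} {B : ℝ} (ha : ∀ n i j, |a n i j| ≤ B) :
    ∀ᵐ ω ∂P, ∀ ε : ℝ, 0 < ε → ∀ᶠ n in atTop, ∀ i,
      |∑ j, a n i j * (w n i j ω - p n i j)| ≤ ε * (n * scaling γ n) := by
  have key : ∀ ε : ℝ, 0 < ε → ∀ᵐ ω ∂P, ∀ᶠ n in atTop, ∀ i,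
      |∑ j, a n i j * (w n i j ω - p n i j)| ≤ ε * (n * scaling γ n) := by
    intro ε hε
    set B' := |B| + 1
    set C' := |C| + 1
    have hB' : 0 < B' := by positivity
    have hC' : 0 < C' := by positivity
    have haB : ∀ n i j, |a n i j| ≤ B' := fun n i j =>
      (ha n i j).trans (by linarith [le_abs_self B])
    -- The threshold and the bound on ∑ p both scale like n^{1-γ}, so one t serves all n: it is
    -- chosen so that the quadratic term eats at most half of the linear one.
    obtain ⟨t, ht, htB, htε⟩ : ∃ t : ℝ, 0 < t ∧ t * B' ≤ 1 ∧ t * (B' ^ 2 * C') ≤ ε / 2 := by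
      refine ⟨min (1 / B') (ε / 2 / (B' ^ 2 * C')), by positivity, ?_, ?_⟩
      · exact (le_div_iff₀ hB').1 (min_le_left _ _)
      · exact (le_div_iff₀ (by positivity)).1 (min_le_right _ _)
    set c := t * (ε / 2)
    have hc : 0 < c := by positivity
    have hs : ∀ n : ℕ, 0 < n → (n : ℝ) * scaling γ n = (n : ℝ) ^ (1 - γ) := by
      intro n hn
      have hn' : (0 : ℝ) < n := by exact_mod_cast hn
      rw [scaling, sub_eq_add_neg, Real.rpow_add hn', Real.rpow_one]
    set E : ℕ → Set Ω := fun n => ⋃ i : Fin n,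
      {ω | ε * (n * scaling γ n) ≤ |∑ j, a n i j * (w n i j ω - p n i j)|}
    have hrow : ∀ n (i : Fin n), P.real
        {ω | ε * (n * scaling γ n) ≤ |∑ j, a n i j * (w n i j ω - p n i j)|} ≤
        2 * Real.exp (-c * (n : ℝ) ^ (1 - γ)) := by
      intro n i
      refine (measureReal_le_abs_sum_bernoulli_sub (hm n i) (h01 n i) (hp n i) (hP n i) (hind n i)
        ht.le htB (haB n i)).trans ?_
      have hS := hs n i.pos
      have hSnn : 0 ≤ (n : ℝ) ^ (1 - γ) := by positivity
      have hsum : ∑ j, p n i j ≤ C' * (n : ℝ) ^ (1 - γ) := by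
        rw [← hS] at hSnn ⊢
        exact (hpC n i).trans (mul_le_mul_of_nonneg_right (by linarith [le_abs_self C]) hSnn)
      rw [hS]
      gcongr
      calc -t * (ε * (n : ℝ) ^ (1 - γ)) + t ^ 2 * B' ^ 2 * ∑ j, p n i j
          ≤ -t * (ε * (n : ℝ) ^ (1 - γ)) + t ^ 2 * B' ^ 2 * (C' * (n : ℝ) ^ (1 - γ)) := by gcongr
        _ = -t * (ε * (n : ℝ) ^ (1 - γ)) + t * (t * (B' ^ 2 * C')) * (n : ℝ) ^ (1 - γ) := by ring
        _ ≤ -t * (ε * (n : ℝ) ^ (1 - γ)) + t * (ε / 2) * (n : ℝ) ^ (1 - γ) := by gcongr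
        _ = -c * (n : ℝ) ^ (1 - γ) := by simp only [c]; ring
    have hE : ∀ n, P (E n) ≤
        ENNReal.ofReal ((n : ℝ) * (2 * Real.exp (-c * (n : ℝ) ^ (1 - γ)))) := by
      intro n
      rw [← ofReal_measureReal]
      refine ENNReal.ofReal_le_ofReal ((measureReal_iUnion_fintype_le _).trans ?_)
      refine (Finset.sum_le_sum fun i _ => hrow n i).trans ?_
      simp
    -- Summability suffices for this half of Borel–Cantelli, so the joint law for different n plays
    -- no role.
    have hsum : ∑' n, P (E n) ≠ ∞ :=
      ne_top_of_le_ne_top (summable_mul_exp_neg_rpow hc (by linarith)).tsum_ofReal_ne_top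
        (ENNReal.tsum_le_tsum hE)
    filter_upwards [ae_eventually_notMem hsum] with ω hω
    filter_upwards [hω] with n hn i
    simp only [E, mem_iUnion, mem_ofPred_eq, not_exists, not_le] at hn
    exact (hn i).le
  -- Countably many tolerances give a single null set.
  have hall : ∀ᵐ ω ∂P, ∀ l : ℕ, ∀ᶠ n in atTop, ∀ i,
      |∑ j, a n i j * (w n i j ω - p n i j)| ≤ 1 / ((l : ℝ) + 1) * (n * scaling γ n) :=
    ae_all_iff.2 fun l => key _ (by positivity)
  filter_upwards [hall] with ω hω ε hε
  obtain ⟨l, hl⟩ := exists_nat_one_div_lt hε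
  filter_upwards [hω l] with n hn i
  refine (hn i).trans ?_
  have : 0 ≤ (n : ℝ) * scaling γ n := by unfold scaling; positivity
  gcongr

end probability

/-! ### Expected weights, and rows and columns of the graph sequences. -/

theorem scaling_nonneg (γ : ℝ) (n : ℕ) : 0 ≤ scaling γ n := by unfold scaling; positivity

theorem scaling_pos (γ : ℝ) {n : ℕ} (hn : 0 < n) : 0 < scaling γ n := by
  unfold scaling; positivity

theorem scaling_zero (n : ℕ) : scaling 0 n = 1 := by simp [scaling]

theorem tendsto_inv_scaling {γ : ℝ} (hγ : 0 < γ) :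
    Tendsto (fun n => (scaling γ n)⁻¹) atTop atTop := by
  have h : (fun n : ℕ => (scaling γ n)⁻¹) = fun n : ℕ => (n : ℝ) ^ γ := by
    funext n
    rw [scaling, Real.rpow_neg (by positivity), inv_inv]
  rw [h]
  exact (tendsto_rpow_atTop hγ).comp tendsto_natCast_atTop_atTop

/-- The graphon whose averages give the expected weights on `n` nodes. -/
def meanGraphon (T : GraphType) (γ : ℝ) (W : ℝ × ℝ → ℝ) (n : ℕ) : ℝ × ℝ → ℝ :=
  match T with
  | .deterministicDense => W
  | .randomDense => W
  | .randomSparse => fun p => min (scaling γ n)⁻¹ (W p)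

theorem abs_meanGraphon_le (T : GraphType) (γ : ℝ) (W : ℝ × ℝ → ℝ) (n : ℕ) (p : ℝ × ℝ) :
    |meanGraphon T γ W n p| ≤ |W p| := by
  cases T
  · exact le_rfl
  · exact le_rfl
  · exact abs_min_le_abs (inv_nonneg.2 (scaling_nonneg γ n))

theorem memLp_meanGraphon (T : GraphType) (γ : ℝ) {W : ℝ × ℝ → ℝ}
    (hW : MemLp W 2 (μI.prod μI)) (n : ℕ) : MemLp (meanGraphon T γ W n) 2 (μI.prod μI) := by
  cases T
  · exact hW
  · exact hW
  · exact memLp_min hW (inv_nonneg.2 (scaling_nonneg γ n))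

theorem tendsto_stepKernel_meanGraphon {T : GraphType} {γ : ℝ} (hγ : T = .randomSparse → 0 < γ)
    {W : ℝ × ℝ → ℝ} (hW : MemLp W 2 (μI.prod μI)) :
    Tendsto (fun n => eLpNorm (stepKernel n (meanGraphon T γ W n) - W) 2 (μI.prod μI)) atTop
      (𝓝 0) := by
  refine tendsto_stepKernel_of_tendsto hW (memLp_meanGraphon T γ hW) ?_
  cases T
  · simp [meanGraphon]
  · simp [meanGraphon]
  · exact tendsto_eLpNorm_min_sub hW (fun n => inv_nonneg.2 (scaling_nonneg γ n))
      (tendsto_inv_scaling (hγ rfl))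

theorem cellAvg_nonneg {V : ℝ × ℝ → ℝ} (hV : ∀ᵐ p ∂(μI.prod μI), 0 ≤ V p) (n : ℕ) (i j : Fin n) :
    0 ≤ cellAvg V n i j := by
  rw [cellAvg_eq_setAverage, setAverage_eq]
  exact smul_nonneg (by positivity) (integral_nonneg_of_ae (ae_restrict_of_ae hV))

section probability

variable {Ω : Type*} [MeasurableSpace Ω] {P : Measure Ω} [IsProbabilityMeasure P]

/-- `w` is an array of constants `p`, or a row-wise independent array of Bernoulli variables with
parameters `p`. -/
def IsConstOrBernoulli (P : Measure Ω) (w : (n : ℕ) → Fin n → Fin n → Ω → ℝ)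
    (p : (n : ℕ) → Fin n → Fin n → ℝ) : Prop :=
  (∀ n i j ω, w n i j ω = p n i j) ∨
    ((∀ n i j, Measurable (w n i j)) ∧ (∀ n i j ω, w n i j ω = 0 ∨ w n i j ω = 1) ∧
      (∀ n i j, 0 ≤ p n i j) ∧ (∀ n i j, P {ω | w n i j ω = 1} = ENNReal.ofReal (p n i j)) ∧
      ∀ n i, iIndepFun (w n i) P)

theorem IsConstOrBernoulli.ae_tendsto_rows {γ : ℝ} (hγ : γ < 1)
    {w : (n : ℕ) → Fin n → Fin n → Ω → ℝ} {p : (n : ℕ) → Fin n → Fin n → ℝ}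
    (h : IsConstOrBernoulli P w p) {C : ℝ} (hpC : ∀ n i, ∑ j, |p n i j| ≤ C * (n * scaling γ n))
    {a : (n : ℕ) → Fin n → Fin n → ℝ} {B : ℝ} (ha : ∀ n i j, |a n i j| ≤ B) :
    ∀ᵐ ω ∂P, ∀ ε : ℝ, 0 < ε → ∀ᶠ n in atTop, ∀ i,
      |∑ j, a n i j * (w n i j ω - p n i j)| ≤ ε * (n * scaling γ n) := by
  rcases h with h | ⟨hm, h01, hp, hP, hind⟩
  · refine Eventually.of_forall fun ω ε hε => Eventually.of_forall fun n i => ?_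
    have := scaling_nonneg γ n
    simp only [h, sub_self, mul_zero, Finset.sum_const_zero, abs_zero]
    positivity
  · exact ae_tendsto_rows_bernoulli hγ hm h01 hp hP hind
      (fun n i => (Finset.sum_le_sum fun j _ => le_abs_self _).trans (hpC n i)) ha

/-- Concentration with unit coefficients: a row sum differs from its mean by at most n α eventually,
whence C + 1. -/
theorem IsConstOrBernoulli.ae_sum_abs_le {γ : ℝ} (hγ : γ < 1)
    {w : (n : ℕ) → Fin n → Fin n → Ω → ℝ} {p : (n : ℕ) → Fin n → Fin n → ℝ}
    (h : IsConstOrBernoulli P w p) {C : ℝ} (hpC : ∀ n i, ∑ j, |p n i j| ≤ C * (n * scaling γ n)) :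
    ∀ᵐ ω ∂P, ∀ᶠ n in atTop, ∀ i, ∑ j, |w n i j ω| ≤ (C + 1) * (n * scaling γ n) := by
  filter_upwards [h.ae_tendsto_rows hγ hpC (a := fun _ _ _ => 1) (B := 1) (by simp)] with ω hω
  filter_upwards [hω 1 one_pos] with n hn i
  have hnn : 0 ≤ (n : ℝ) * scaling γ n := mul_nonneg n.cast_nonneg (scaling_nonneg γ n)
  rcases h with h | ⟨hm, h01, hp, hP, hind⟩
  · simp only [h]
    linarith [hpC n i]
  · have h1 : ∀ j, |w n i j ω| = 1 * (w n i j ω - p n i j) + |p n i j| := by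
      intro j
      rw [abs_of_nonneg (hp n i j), abs_of_nonneg (by rcases h01 n i j ω with h | h <;> simp [h])]
      ring
    simp only [h1, Finset.sum_add_distrib]
    linarith [hpC n i, hn i, le_abs_self (∑ j, 1 * (w n i j ω - p n i j))]

end probability

section graphs

variable {Ω : Type*} [MeasurableSpace Ω] {P : Measure Ω} {m : ℕ}
  {ty : Fin m → GraphType} {und : Fin m → Prop} {W : Fin m → ℝ × ℝ → ℝ} {γ : Fin m → ℝ}
  {w : (n : ℕ) → Fin m → Fin n → Fin n → Ω → ℝ}

/-- In an undirected graph the edge joining i and j is listed as (min, max). For fixed i this is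
injective in j, since min + max = i + j, so a row is a subfamily of the independent edges. -/
theorem IsGraphSequence.indep_row (hw : IsGraphSequence P ty und W γ w) (n : ℕ) (k : Fin m)
    (i : Fin n) : iIndepFun (fun j => w n k i j) P := by
  by_cases hk : und k
  · let e : Fin n → {e : Fin m × Fin n × Fin n // und e.1 → e.2.1 ≤ e.2.2} :=
      fun j => ⟨(k, min i j, max i j), fun _ => min_le_max⟩
    have he : Function.Injective e := by
      intro j j' h
      simp only [e, Subtype.mk.injEq, Prod.mk.injEq, true_and] at h
      obtain ⟨h1, h2⟩ := h
      have := min_add_max (i : ℕ) j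
      have := min_add_max (i : ℕ) j'
      have h1' := congrArg Fin.val h1
      have h2' := congrArg Fin.val h2
      simp only [Fin.coe_min, Fin.coe_max] at h1' h2'
      exact Fin.ext (by omega)
    have h := (hw.indep n).precomp he
    have heq : (fun j => w n k i j) = fun j ω => w n (e j).1.1 (e j).1.2.1 (e j).1.2.2 ω := by
      funext j ω
      rcases le_total i j with hij | hij
      · simp [e, hij]
      · simp only [e, hij, min_eq_right, max_eq_left]
        exact hw.weight_symm k hk n i j ω
    rw [heq]
    exact h
  · let e : Fin n → {e : Fin m × Fin n × Fin n // und e.1 → e.2.1 ≤ e.2.2} :=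
      fun j => ⟨(k, i, j), fun h => absurd h hk⟩
    have he : Function.Injective e := by
      intro j j' h
      simpa [e] using h
    have h := (hw.indep n).precomp he
    exact h

theorem IsGraphSequence.indep_col (hw : IsGraphSequence P ty und W γ w) (n : ℕ) (k : Fin m)
    (i : Fin n) : iIndepFun (fun j => w n k j i) P := by
  by_cases hk : und k
  · have heq : (fun j => w n k j i) = fun j => w n k i j := by
      funext j ω
      exact hw.weight_symm k hk n j i ω
    rw [heq]
    exact hw.indep_row n k i
  · let e : Fin n → {e : Fin m × Fin n × Fin n // und e.1 → e.2.1 ≤ e.2.2} :=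
      fun j => ⟨(k, j, i), fun h => absurd h hk⟩
    have he : Function.Injective e := by
      intro j j' h
      simpa [e] using h
    have h := (hw.indep n).precomp he
    exact h

theorem IsGraphSequence.mean_nonneg (hw : IsGraphSequence P ty und W γ w) {k : Fin m}
    (hk : ty k ≠ .deterministicDense) (n : ℕ) (i j : Fin n) :
    0 ≤ scaling (γ k) n * cellAvg (meanGraphon (ty k) (γ k) (W k) n) n i j := by
  refine mul_nonneg (scaling_nonneg _ n) (cellAvg_nonneg ?_ n i j)
  rcases h : ty k with _ | _ | _
  · exact absurd h hk
  · filter_upwards [hw.dense_range k h] with p hp using hp.1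
  · filter_upwards [hw.sparse_nonneg k h] with p hp
    exact le_min (inv_nonneg.2 (scaling_nonneg _ n)) hp

theorem IsGraphSequence.measure_weight_eq_one (hw : IsGraphSequence P ty und W γ w) {k : Fin m}
    (hγ : ty k ≠ .randomSparse → γ k = 0) (hk : ty k ≠ .deterministicDense) (n : ℕ)
    (i j : Fin n) : P {ω | w n k i j ω = 1} =
      ENNReal.ofReal (scaling (γ k) n * cellAvg (meanGraphon (ty k) (γ k) (W k) n) n i j) := by
  rcases h : ty k with _ | _ | _
  · exact absurd h hk
  · rw [hw.dense_prob k h, hγ (by simp [h]), scaling_zero, one_mul]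
    rfl
  · exact hw.sparse_prob k h n i j

theorem IsGraphSequence.weight_eq_of_deterministic (hw : IsGraphSequence P ty und W γ w)
    {k : Fin m} (hγ : ty k ≠ .randomSparse → γ k = 0) (hk : ty k = .deterministicDense) (n : ℕ)
    (i j : Fin n) (ω : Ω) : w n k i j ω =
      scaling (γ k) n * cellAvg (meanGraphon (ty k) (γ k) (W k) n) n i j := by
  rw [hw.deterministic k hk, hγ (by simp [hk]), scaling_zero, one_mul, hk]
  rfl

theorem IsGraphSequence.isConstOrBernoulli (hw : IsGraphSequence P ty und W γ w) {k : Fin m}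
    (hγ : ty k ≠ .randomSparse → γ k = 0) :
    IsConstOrBernoulli P (fun n i j => w n k i j) fun n i j =>
      scaling (γ k) n * cellAvg (meanGraphon (ty k) (γ k) (W k) n) n i j := by
  by_cases hk : ty k = .deterministicDense
  · exact Or.inl (hw.weight_eq_of_deterministic hγ hk)
  · exact Or.inr ⟨fun n => hw.measurable n k, hw.zero_or_one k hk, hw.mean_nonneg hk,
      hw.measure_weight_eq_one hγ hk, fun n => hw.indep_row n k⟩

/-- The transposed array turns the row estimates into the column sums needed by the Schur test. -/
theorem IsGraphSequence.isConstOrBernoulli_transpose (hw : IsGraphSequence P ty und W γ w)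
    {k : Fin m} (hγ : ty k ≠ .randomSparse → γ k = 0) :
    IsConstOrBernoulli P (fun n i j => w n k j i) fun n i j =>
      scaling (γ k) n * cellAvg (meanGraphon (ty k) (γ k) (W k) n) n j i := by
  by_cases hk : ty k = .deterministicDense
  · exact Or.inl fun n i j => hw.weight_eq_of_deterministic hγ hk n j i
  · exact Or.inr ⟨fun n i j => hw.measurable n k j i, fun n i j => hw.zero_or_one k hk n j i,
      fun n i j => hw.mean_nonneg hk n j i, fun n i j => hw.measure_weight_eq_one hγ hk n j i,
      fun n => hw.indep_col n k⟩

end graphs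

/-! ### Uniformity in time and Gronwall's inequality. -/

/-- Equicontinuous families which vanish in the limit at rational points vanish uniformly. -/
theorem eventually_forall_le_of_tendsto_rat {E : Type*} [SeminormedAddCommGroup E] {u : ℝ → E}
    (hu : Continuous u) {e : ℕ → ℝ → ℝ} {K : ℝ} (hK : 0 ≤ K)
    (he : ∀ᶠ n in atTop, ∀ s t, e n s ≤ e n t + K * ‖u s - u t‖)
    (hq : ∀ q : ℚ, Tendsto (fun n => e n q) atTop (𝓝 0)) {S : Set ℝ} (hS : IsCompact S) {ε : ℝ}
    (hε : 0 < ε) : ∀ᶠ n in atTop, ∀ t ∈ S, e n t ≤ ε := by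
  refine hS.induction_on (p := fun S => ∀ᶠ n in atTop, ∀ t ∈ S, e n t ≤ ε) (by simp)
    (fun s t hst ht => ht.mono fun n hn x hx => hn x (hst hx))
    (fun s t hs ht => by
      filter_upwards [hs, ht] with n h1 h2 x hx
      exact hx.elim (h1 x) (h2 x)) fun t _ => ?_
  -- Both s and a nearby rational q have u within this distance of u t, so passing from q to s costs
  -- at most ε / 2; K + 1 avoids division by 0.
  have hη : 0 < ε / (4 * (K + 1)) := by positivity
  set U := {s | ‖u s - u t‖ < ε / (4 * (K + 1))}
  have hUo : IsOpen U := isOpen_lt (hu.sub continuous_const).norm continuous_const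
  have htU : t ∈ U := by
    change ‖u t - u t‖ < _
    simpa using hη
  obtain ⟨q, hqU⟩ := Rat.denseRange_cast.exists_mem_open hUo ⟨t, htU⟩
  refine ⟨U, mem_nhdsWithin_of_mem_nhds (hUo.mem_nhds htU), ?_⟩
  filter_upwards [he, (hq q).eventually_lt_const (half_pos hε)] with n hn hnq s hs
  have hs' : ‖u s - u t‖ < ε / (4 * (K + 1)) := hs
  have hq' : ‖u q - u t‖ < ε / (4 * (K + 1)) := hqU
  have h1 : ‖u s - u q‖ ≤ ε / (2 * (K + 1)) := by
    have := norm_sub_le_norm_sub_add_norm_sub (u s) (u t) (u q)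
    rw [norm_sub_rev (u t)] at this
    have h2 : ε / (4 * (K + 1)) + ε / (4 * (K + 1)) = ε / (2 * (K + 1)) := by field_simp; ring
    linarith
  have h3 : K * ‖u s - u q‖ ≤ ε / 2 := by
    calc K * ‖u s - u q‖ ≤ (K + 1) * (ε / (2 * (K + 1))) := by gcongr; linarith
      _ = ε / 2 := by field_simp
  linarith [hn s q]

/-- The right-hand side of the network equation. -/
def networkField {m : ℕ} (n : ℕ) (F : ℝ → ℝ) (D : Fin m → ℝ → ℝ)
    (a : Fin m → Fin n → Fin n → ℝ) (φ : Fin n → ℝ) (i : Fin n) : ℝ :=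
  F (φ i) + ∑ k, interaction n (a k) (D k) φ i

theorem norm_stepLp_networkField_sub_le {m n : ℕ} {F : ℝ → ℝ} {LF : ℝ≥0}
    (hF : LipschitzWith LF F) {D : Fin m → ℝ → ℝ} {L : Fin m → ℝ≥0}
    (hL : ∀ k, LipschitzWith (L k) (D k)) {a : Fin m → Fin n → Fin n → ℝ} {R : ℝ} (hR : 0 ≤ R)
    (hrow : ∀ k i, ∑ j, |a k i j| ≤ R * n) (hcol : ∀ k j, ∑ i, |a k i j| ≤ R * n)
    (φ ψ : Fin n → ℝ) :
    ‖stepLp n (networkField n F D a φ) - stepLp n (networkField n F D a ψ)‖ ≤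
      (LF + ∑ k, 2 * L k * R) * ‖stepLp n φ - stepLp n ψ‖ := by
  have hsplit : ∀ φ, networkField n F D a φ =
      (fun i => F (φ i)) + ∑ k, interaction n (a k) (D k) φ := by
    intro φ
    funext i
    simp [networkField]
  have hFle : ‖stepLp n (fun i => F (φ i)) - stepLp n (fun i => F (ψ i))‖ ≤
      LF * ‖stepLp n φ - stepLp n ψ‖ := by
    rw [← stepLp_sub, ← stepLp_sub]
    refine norm_stepLp_le_of_sq_le LF.coe_nonneg ?_
    rw [Finset.mul_sum]
    refine Finset.sum_le_sum fun i _ => ?_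
    rw [← mul_pow]
    refine sq_le_sq.2 ?_
    rw [abs_mul, abs_of_nonneg LF.coe_nonneg]
    simpa [Real.dist_eq] using hF.dist_le_mul (φ i) (ψ i)
  rw [hsplit, hsplit, stepLp_add, stepLp_add, stepLp_sum, stepLp_sum, add_sub_add_comm,
    ← Finset.sum_sub_distrib, add_mul, Finset.sum_mul]
  refine (norm_add_le _ _).trans (add_le_add hFle ((norm_sum_le _ _).trans ?_))
  exact Finset.sum_le_sum fun k _ =>
    norm_stepLp_interaction_sub_le (hL k) hR (hrow k) (hcol k) φ ψ

theorem IsDiscreteSolution.hasDerivAt_stepLp {m : ℕ} {f : ℝ → ℝ → ℝ} {D : Fin m → ℝ → ℝ} {g : L2I}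
    {n : ℕ} {α : Fin m → ℝ} {w : Fin m → Fin n → Fin n → ℝ} {v : ℝ → Fin n → ℝ}
    (hv : IsDiscreteSolution f D g n α w v) (t : ℝ) :
    HasDerivAt (fun s => stepLp n (v s))
      (stepLp n (networkField n (fun x => f x t) D (fun k i j => w k i j / α k) (v t))) t := by
  have hode : ∀ i, HasDerivAt (fun s => v s i)
      (networkField n (fun x => f x t) D (fun k i j => w k i j / α k) (v t) i) t := by
    intro i
    convert hv.ode t i using 1
    unfold networkField
    congr 1
    refine Finset.sum_congr rfl fun k _ => ?_
    rw [interaction, Finset.mul_sum, Finset.mul_sum]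
    refine Finset.sum_congr rfl fun j _ => ?_
    rw [one_div, one_div, mul_inv]
    ring
  unfold stepLp
  exact HasDerivAt.fun_sum fun i _ => (hode i).smul_const _

theorem gronwallBound_self {η K T : ℝ} (hK : 0 < K) :
    gronwallBound η K η T = η * (Real.exp (K * T) + 1 / K * (Real.exp (K * T) - 1)) := by
  rw [gronwallBound, if_neg hK.ne']
  ring

/-- Stability and consistency of approximating equations give convergence. -/
theorem tendsto_uniformly_of_consistent {E : Type*} [NormedAddCommGroup E] [NormedSpace ℝ E]
    {G : ℕ → ℝ → E → E} {K : ℝ≥0} (hG : ∀ᶠ n in atTop, ∀ t, LipschitzWith K (G n t))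
    {x : ℕ → ℝ → E} (hx : ∀ n t, HasDerivAt (x n) (G n t (x n t)) t) {u : ℝ → E}
    (hu : ContDiff ℝ 1 u) (h0 : Tendsto (fun n => x n 0) atTop (𝓝 (u 0))) {T : ℝ}
    (herr : ∀ ε : ℝ, 0 < ε → ∀ᶠ n in atTop, ∀ t ∈ Icc 0 T, ‖G n t (u t) - deriv u t‖ ≤ ε)
    {ε : ℝ} (hε : 0 < ε) : ∀ᶠ n in atTop, ∀ t ∈ Icc 0 T, ‖x n t - u t‖ ≤ ε := by
  rcases lt_or_ge T 0 with hT | hT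
  · simp [Icc_eq_empty_of_lt hT]
  -- A positive constant avoids the separate formula of `gronwallBound` at 0. With initial error and
  -- defect both ε / A, the bound at time T is exactly ε.
  set K' : ℝ≥0 := K + 1
  have hK' : (0 : ℝ) < K' := by positivity
  set A : ℝ := Real.exp (K' * T) + 1 / K' * (Real.exp (K' * T) - 1) with hA_def
  have hA : 0 < A := by
    have h1 : 1 ≤ Real.exp (K' * T) := Real.one_le_exp (by positivity)
    have h2 : 0 ≤ 1 / (K' : ℝ) * (Real.exp (K' * T) - 1) :=
      mul_nonneg (by positivity) (by linarith)
    linarith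
  have hη : 0 < ε / A := by positivity
  have h0' : ∀ᶠ n in atTop, dist (x n 0) (u 0) ≤ ε / A :=
    (Metric.tendsto_nhds.1 h0 _ hη).mono fun n hn => hn.le
  filter_upwards [hG, h0', herr _ hη] with n hLip hini hcons t ht
  have hdu : ∀ t, HasDerivAt u (deriv u t) t := fun t =>
    ((hu.differentiable one_ne_zero) t).hasDerivAt
  have h := dist_le_of_approx_trajectories_ODE (v := G n) (K := K') (f := x n) (g := u)
    (f' := fun t => G n t (x n t)) (g' := deriv u) (a := 0) (b := T) (εf := 0) (εg := ε / A)
    (δ := ε / A) (fun t => (hLip t).weaken (by simp [K']))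
    (fun t _ => (hx n t).continuousAt.continuousWithinAt)
    (fun t _ => (hx n t).hasDerivWithinAt) (fun t _ => by simp)
    hu.continuous.continuousOn (fun t _ => (hdu t).hasDerivWithinAt)
    (fun t ht => by
      rw [dist_comm, dist_eq_norm]
      exact hcons t (Ico_subset_Icc_self ht)) hini t ht
  rw [dist_eq_norm, zero_add, sub_zero] at h
  calc ‖x n t - u t‖ ≤ gronwallBound (ε / A) K' (ε / A) t := h
    _ ≤ gronwallBound (ε / A) K' (ε / A) T := gronwallBound_mono hη.le hη.le hK'.le ht.2
    _ = ε := by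
        rw [gronwallBound_self hK', ← hA_def]
        field_simp

theorem interaction_div_sub_eq {n : ℕ} {α : ℝ} (hα : α ≠ 0) (w b : Fin n → Fin n → ℝ) (D : ℝ → ℝ)
    (φ : Fin n → ℝ) (i : Fin n) :
    interaction n ((fun i j => w i j / α) - b) D φ i =
      1 / (n * α) * ∑ j, D (φ j - φ i) * (w i j - α * b i j) := by
  rw [interaction, Finset.mul_sum, Finset.mul_sum]
  refine Finset.sum_congr rfl fun j _ => ?_
  simp only [Pi.sub_apply]
  rcases Nat.eq_zero_or_pos n with rfl | hn
  · exact i.elim0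
  · field_simp

/-- On a good event, the fluctuations of the network field along `u` vanish uniformly. -/
theorem eventually_norm_fluctuation_le {D : ℝ → ℝ} {L : ℝ≥0} (hL : LipschitzWith L D)
    {α : ℕ → ℝ} (hα : ∀ n, 0 < n → 0 < α n) {w b : (n : ℕ) → Fin n → Fin n → ℝ} {R : ℝ}
    (hR : 0 ≤ R)
    (hw_row : ∀ᶠ n in atTop, ∀ i, ∑ j, |w n i j / α n| ≤ R * n)
    (hw_col : ∀ᶠ n in atTop, ∀ j, ∑ i, |w n i j / α n| ≤ R * n)
    (hb_row : ∀ n i, ∑ j, |b n i j| ≤ R * n) (hb_col : ∀ n j, ∑ i, |b n i j| ≤ R * n)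
    {u : ℝ → L2I} (hu : Continuous u)
    (hconc : ∀ q : ℚ, ∀ ε : ℝ, 0 < ε → ∀ᶠ n in atTop, ∀ i,
      |∑ j, D (cellMean n (u q) j - cellMean n (u q) i) * (w n i j - α n * b n i j)| ≤
        ε * (n * α n))
    {S : Set ℝ} (hS : IsCompact S) {ε : ℝ} (hε : 0 < ε) :
    ∀ᶠ n in atTop, ∀ t ∈ S,
      ‖stepLp n (interaction n ((fun i j => w n i j / α n) - b n) D (cellMean n (u t)))‖ ≤ ε := by
  refine eventually_forall_le_of_tendsto_rat hu (K := 2 * L * (2 * R)) (by positivity) ?_ ?_ hS hε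
  -- Equicontinuity: the centred array has row and column sums at most 2R n, so the Schur test
  -- applies to it.
  · filter_upwards [hw_row, hw_col] with n h1 h2 s t
    have hle : ∀ x y : ℝ, |x - y| ≤ |x| + |y| := abs_sub
    have h3 := norm_stepLp_interaction_sub_le (n := n) (a := (fun i j => w n i j / α n) - b n) hL
      (R := 2 * R) (by positivity)
      (fun i => (Finset.sum_le_sum fun j _ => hle _ _).trans (by
        rw [Finset.sum_add_distrib]; linarith [h1 i, hb_row n i]))
      (fun j => (Finset.sum_le_sum fun i _ => hle _ _).trans (by
        rw [Finset.sum_add_distrib]; linarith [h2 j, hb_col n j]))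
      (cellMean n (u s)) (cellMean n (u t))
    have h4 := mul_le_mul_of_nonneg_left (norm_stepLp_cellMean_sub_le n (u s) (u t))
      (by positivity : 0 ≤ 2 * (L : ℝ) * (2 * R))
    linarith [norm_sub_norm_le
      (stepLp n (interaction n ((fun i j => w n i j / α n) - b n) D (cellMean n (u s))))
      (stepLp n (interaction n ((fun i j => w n i j / α n) - b n) D (cellMean n (u t))))]
  · intro q
    rw [Metric.tendsto_nhds]
    intro η hη
    filter_upwards [hconc q (η / 2) (half_pos hη), eventually_gt_atTop 0] with n hn hn0
    have hαn := hα n hn0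
    have hn' : (0 : ℝ) < n := by exact_mod_cast hn0
    rw [dist_zero_right, norm_norm]
    refine (norm_stepLp_le_of_abs_le (half_pos hη).le fun i => ?_).trans_lt (half_lt_self hη)
    rw [interaction_div_sub_eq hαn.ne', abs_mul, abs_of_pos (by positivity), one_div,
      inv_mul_le_iff₀ (by positivity), mul_comm]
    exact hn i

end

end OscillatorNetwork

/-! ### The main theorem. -/

open OscillatorNetwork in
theorem theorem2 {Ω : Type*} [MeasurableSpace Ω] (P : Measure Ω) [IsProbabilityMeasure P]
    (m : ℕ) (f : ℝ → ℝ → ℝ) (D : Fin m → ℝ → ℝ) (W : Fin m → ℝ × ℝ → ℝ) (g : L2I)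
    -- `f(u,t)` is Lipschitz in `u` and continuous in `t`
    (hf_lip : ∃ L : ℝ≥0, ∀ t, LipschitzWith L (fun x => f x t))
    (hf_cont : ∀ x, Continuous (f x))
    -- the `D k` are Lipschitz and bounded
    (hD_lip : ∀ k, ∃ L : ℝ≥0, LipschitzWith L (D k))
    (hD_bdd : ∀ k, ∃ B : ℝ, ∀ x, |D k x| ≤ B)
    -- the graphons are square integrable, with bounded columns and rows
    (hW : ∀ k, MemLp (W k) 2 (μI.prod μI))
    (C₁ C₂ : ℝ≥0)
    (hW_col : ∀ k, essSup (fun y => ∫⁻ x, ‖W k (x, y)‖ₑ ∂μI) μI ≤ C₁)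
    (hW_row : ∀ k, essSup (fun x => ∫⁻ y, ‖W k (x, y)‖ₑ ∂μI) μI ≤ C₂)
    -- the graphs
    (ty : Fin m → GraphType) (und : Fin m → Prop) (γ : Fin m → ℝ)
    (hγ_dense : ∀ k, ty k ≠ .randomSparse → γ k = 0)
    (hγ_sparse : ∀ k, ty k = .randomSparse → γ k ∈ Ioo (0 : ℝ) (1 / 2))
    (w : (n : ℕ) → Fin m → Fin n → Fin n → Ω → ℝ)
    (hw : IsGraphSequence P ty und W γ w)
    -- the solutions of the network equations and of the continuum limit
    (v : (n : ℕ) → Ω → ℝ → Fin n → ℝ)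
    (hv : ∀ n ω, IsDiscreteSolution f D g n (fun k => scaling (γ k) n)
      (fun k i j => w n k i j ω) (v n ω))
    (u : ℝ → L2I) (hu : IsContinuumSolution f D W g u) :
    ∀ T : ℝ, 0 < T → ∀ᵐ ω ∂P, ∃ M : ℕ → ℝ,
      (∀ n, IsGreatest ((fun t => ‖stepLp n (v n ω t) - u t‖) '' Icc 0 T) (M n)) ∧
      Tendsto M atTop (𝓝 0) := by
  intro T hT
  obtain ⟨LF, hLF⟩ := hf_lip
  choose L hL using hD_lip
  choose B hB using hD_bdd
  have hγ1 : ∀ k, γ k < 1 := by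
    intro k
    by_cases hk : ty k = .randomSparse
    · linarith [(hγ_sparse k hk).2]
    · rw [hγ_dense k hk]; norm_num
  have hγ0 : ∀ k, ty k = .randomSparse → 0 < γ k := fun k hk => (hγ_sparse k hk).1
  set V : Fin m → ℕ → ℝ × ℝ → ℝ := fun k n => meanGraphon (ty k) (γ k) (W k) n
  have hVW : ∀ k n p, |V k n p| ≤ |W k p| := fun k n p => abs_meanGraphon_le _ _ _ n p
  set C : ℝ := C₁ + C₂ with hC_def
  have hC : 0 ≤ C := by positivity
  have hV_row : ∀ k n i, ∑ j, |cellAvg (V k n) n i j| ≤ C * n := fun k n i =>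
    (sum_row_abs_cellAvg_le (hW k) (hW_row k) (hVW k n) n i).trans
      (by gcongr; simp [hC_def])
  have hV_col : ∀ k n j, ∑ i, |cellAvg (V k n) n i j| ≤ C * n := fun k n j =>
    (sum_col_abs_cellAvg_le (hW k) (hW_col k) (hVW k n) n j).trans
      (by gcongr; simp [hC_def])
  have hscale : ∀ (n : ℕ) {s r : ℝ} {c : Fin n → ℝ}, ∑ j, |c j| ≤ r * n → 0 ≤ s →
      ∑ j, |s * c j| ≤ r * (n * s) := by
    intro n s r c h hs
    simp only [abs_mul, ← Finset.mul_sum, abs_of_nonneg hs]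
    nlinarith
  have hdiv : ∀ k (n : ℕ) {r : ℝ} {c : Fin n → ℝ}, 0 < n → ∑ j, |c j| ≤ r * (n * scaling (γ k) n) →
      ∑ j, |c j / scaling (γ k) n| ≤ r * n := by
    intro k n r c hn h
    have hs := scaling_pos (γ k) hn
    simp only [abs_div, ← Finset.sum_div, abs_of_pos hs]
    rw [div_le_iff₀ hs]
    linarith
  have hp_row : ∀ k n i, ∑ j, |scaling (γ k) n * cellAvg (V k n) n i j| ≤
      C * (n * scaling (γ k) n) := fun k n i => hscale n (hV_row k n i) (scaling_nonneg _ n)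
  have hp_col : ∀ k n j, ∑ i, |scaling (γ k) n * cellAvg (V k n) n i j| ≤
      C * (n * scaling (γ k) n) := fun k n j => hscale n (hV_col k n j) (scaling_nonneg _ n)
  have hrow := ae_all_iff.2 fun k =>
    (hw.isConstOrBernoulli (hγ_dense k)).ae_sum_abs_le (hγ1 k) (hp_row k)
  have hcol := ae_all_iff.2 fun k =>
    (hw.isConstOrBernoulli_transpose (hγ_dense k)).ae_sum_abs_le (hγ1 k) (hp_col k)
  -- The coefficients come from u at a rational time: they are nonrandom and bounded by B k, and
  -- countably many times keep one null set.
  have hconc := ae_all_iff.2 fun k => ae_all_iff.2 fun q : ℚ =>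
    (hw.isConstOrBernoulli (hγ_dense k)).ae_tendsto_rows (hγ1 k) (hp_row k)
      (a := fun n i j => D k (cellMean n (u q) j - cellMean n (u q) i)) (fun n i j => hB k _)
  filter_upwards [hrow, hcol, hconc] with ω hrow hcol hconc
  have hrow' : ∀ k, ∀ᶠ n in atTop, ∀ i, ∑ j, |w n k i j ω / scaling (γ k) n| ≤ (C + 1) * n := by
    intro k
    filter_upwards [hrow k, eventually_gt_atTop 0] with n h hn i using hdiv k n hn (h i)
  have hcol' : ∀ k, ∀ᶠ n in atTop, ∀ j, ∑ i, |w n k i j ω / scaling (γ k) n| ≤ (C + 1) * n := by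
    intro k
    filter_upwards [hcol k, eventually_gt_atTop 0] with n h hn j using hdiv k n hn (h j)
  -- Averaging first defines the network field on all of L²(I), so that u t can be inserted.
  set G : ℕ → ℝ → L2I → L2I := fun n t φ => stepLp n (networkField n (fun x => f x t) D
    (fun k i j => w n k i j ω / scaling (γ k) n) (cellMean n φ)) with hG_def
  set K : ℝ≥0 := LF + ∑ k, 2 * L k * (C₁ + C₂ + 1) with hK_def
  have hKcoe : (K : ℝ) = LF + ∑ k, 2 * L k * (C + 1) := by
    simp [hK_def, hC_def]
  have hG : ∀ᶠ n in atTop, ∀ t, LipschitzWith K (G n t) := by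
    filter_upwards [eventually_all.2 hrow', eventually_all.2 hcol'] with n h1 h2 t
    refine LipschitzWith.of_dist_le_mul fun φ ψ => ?_
    rw [dist_eq_norm, dist_eq_norm, hKcoe]
    refine (norm_stepLp_networkField_sub_le (hLF t) hL (by positivity) h1 h2 _ _).trans ?_
    gcongr
    exact norm_stepLp_cellMean_sub_le n φ ψ
  have hx : ∀ n t, HasDerivAt (fun s => stepLp n (v n ω s)) (G n t (stepLp n (v n ω t))) t := by
    intro n t
    have h := (hv n ω).hasDerivAt_stepLp t
    simp only [hG_def, cellMean_stepLp]
    exact h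
  have h0 : Tendsto (fun n => stepLp n (v n ω 0)) atTop (𝓝 (u 0)) := by
    rw [hu.initial]
    refine (tendsto_stepLp_cellMean g).congr fun n => ?_
    congr 1
    funext i
    rw [(hv n ω).initial i, cellMean]
  have huc : Continuous u := hu.contDiff.continuous
  have hmean : ∀ ε : ℝ, 0 < ε → ∀ᶠ n in atTop, ∀ t ∈ Icc 0 T,
      ‖stepLp n (cellMean n (u t)) - u t‖ ≤ ε := by
    intro ε hε
    refine eventually_forall_le_of_tendsto_rat huc (K := 2) (by norm_num)
      (Eventually.of_forall fun n s t => ?_)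
      (fun q => tendsto_iff_norm_sub_tendsto_zero.1 (tendsto_stepLp_cellMean (u q)))
      isCompact_Icc hε
    have h1 := norm_stepLp_cellMean_sub_le n (u s) (u t)
    have h2 : stepLp n (cellMean n (u s)) - u s = (stepLp n (cellMean n (u t)) - u t) +
        ((stepLp n (cellMean n (u s)) - stepLp n (cellMean n (u t))) - (u s - u t)) := by abel
    rw [h2]
    refine (norm_add_le _ _).trans ?_
    linarith [norm_sub_le (stepLp n (cellMean n (u s)) - stepLp n (cellMean n (u t))) (u s - u t)]
  have hfluct : ∀ k, ∀ ε : ℝ, 0 < ε → ∀ᶠ n in atTop, ∀ t ∈ Icc 0 T,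
      ‖stepLp n (interaction n ((fun i j => w n k i j ω / scaling (γ k) n) - cellAvg (V k n) n)
        (D k) (cellMean n (u t)))‖ ≤ ε := fun k ε hε =>
    eventually_norm_fluctuation_le (hL k) (fun n hn => scaling_pos (γ k) hn)
      (by positivity : 0 ≤ C + 1) (hrow' k) (hcol' k)
      (fun n i => (hV_row k n i).trans (by gcongr; linarith))
      (fun n j => (hV_col k n j).trans (by gcongr; linarith)) huc (hconc k) isCompact_Icc hε
  have hkernel : Tendsto (fun n => ∑ k, B k *
      (eLpNorm (stepKernel n (V k n) - W k) 2 (μI.prod μI)).toReal) atTop (𝓝 0) := by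
    have : Tendsto (fun n => ∑ k, B k *
        (eLpNorm (stepKernel n (V k n) - W k) 2 (μI.prod μI)).toReal) atTop
        (𝓝 (∑ k, B k * (0 : ℝ≥0∞).toReal)) :=
      tendsto_finsetSum _ fun k _ => ((ENNReal.tendsto_toReal ENNReal.zero_ne_top).comp
        (tendsto_stepKernel_meanGraphon (hγ0 k) (hW k))).const_mul _
    simpa using this
  set A : ℝ := LF + ∑ k, L k * ((eLpNorm (W k) 2 (μI.prod μI)).toReal + C₂)
  have hA : 0 ≤ A := by positivity
  have herr : ∀ ε : ℝ, 0 < ε → ∀ᶠ n in atTop, ∀ t ∈ Icc 0 T,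
      ‖G n t (u t) - deriv u t‖ ≤ ε := by
    intro ε hε
    have hε1 : 0 < ε / (3 * (A + 1)) := by positivity
    have hε2 : 0 < ε / (3 * (m + 1)) := by positivity
    filter_upwards [eventually_all.2 fun k => hfluct k _ hε2, hmean _ hε1,
      hkernel.eventually_le_const (by positivity : 0 < ε / 3), eventually_gt_atTop 0]
      with n h1 h2 h3 hn t ht
    -- Mean weights against the continuum equation, plus the fluctuation of each graph. The kernel
    -- error, the averaging error of u t and the total fluctuation each take ε / 3.
    have hsplit : G n t (u t) - deriv u t =
        (stepLp n (fun i => f (cellMean n (u t) i) t +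
          ∑ k, interaction n (cellAvg (V k n) n) (D k) (cellMean n (u t)) i) - deriv u t) +
        ∑ k, stepLp n (interaction n
          ((fun i j => w n k i j ω / scaling (γ k) n) - cellAvg (V k n) n)
          (D k) (cellMean n (u t))) := by
      rw [← stepLp_sum, sub_add_eq_add_sub, ← stepLp_add]
      congr 1
      refine congrArg (stepLp n) ?_
      funext i
      simp only [networkField, interaction_sub_weights, Pi.add_apply, Finset.sum_apply,
        Pi.sub_apply, Finset.sum_sub_distrib]
      ring
    have h4 := norm_averaged_field_sub_le (hLF t) hL hB hW
      (fun k => memLp_meanGraphon (ty k) (γ k) (hW k) n) hW_row hn (hu.equation t)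
    have h5 : A * ‖stepLp n (cellMean n (u t)) - u t‖ ≤ ε / 3 := by
      calc A * ‖stepLp n (cellMean n (u t)) - u t‖ ≤ (A + 1) * (ε / (3 * (A + 1))) := by
            gcongr
            · linarith
            · exact h2 t ht
        _ = ε / 3 := by field_simp
    have h6 : ‖∑ k, stepLp n (interaction n
          ((fun i j => w n k i j ω / scaling (γ k) n) - cellAvg (V k n) n)
          (D k) (cellMean n (u t)))‖ ≤ ε / 3 := by
      refine (norm_sum_le _ _).trans ((Finset.sum_le_sum fun k _ => h1 k t ht).trans ?_)
      rw [Finset.sum_const, Finset.card_univ, Fintype.card_fin, nsmul_eq_mul]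
      calc (m : ℝ) * (ε / (3 * (m + 1))) ≤ (m + 1) * (ε / (3 * (m + 1))) := by
            gcongr; linarith
        _ = ε / 3 := by field_simp
    rw [hsplit]
    refine (norm_add_le _ _).trans ?_
    linarith
  have hcont : ∀ n, Continuous fun t => ‖stepLp n (v n ω t) - u t‖ := fun n =>
    ((continuous_iff_continuousAt.2 fun t => (hx n t).continuousAt).sub huc).norm
  have hmax : ∀ n, ∃ M, IsGreatest ((fun t => ‖stepLp n (v n ω t) - u t‖) '' Icc 0 T) M := fun n =>
    (isCompact_Icc.image (hcont n)).exists_isGreatest ((nonempty_Icc.2 hT.le).image _)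
  choose M hM using hmax
  refine ⟨M, hM, Metric.tendsto_nhds.2 fun ε hε => ?_⟩
  filter_upwards [tendsto_uniformly_of_consistent hG hx hu.contDiff h0 herr (half_pos hε)] with n hn
  obtain ⟨t, ht, hMt⟩ := (hM n).1
  rw [← hMt, dist_zero_right, norm_norm]
  exact (hn t ht).trans_lt (half_lt_self hε)
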